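/- Let $a>0$ and $\kappa\ge 0$ be real numbers with $2\kappa-1+a>0$, and put $\lambda=(2\kappa-1)/a$ (so $\lambda>-1$). For $\nu>-1$ let $$j_\nu(t)=\Gamma(\nu+1)\sum_{n=0}^\infty\frac{(-1)^n (t/2)^{2n}}{n!\,\Gamma(n+\nu+1)}\qquad\bigl(=2^\nu\Gamma(\nu+1)t^{-\nu}J_\nu(t)\ \text{for } t>0\bigr)$$ be the normalized Bessel function. The one-dimensional $(\kappa,a)$-generalized Fourier transform of $f\in\mathcal S(\mathbb R)$ is the function $$\mathcal F_{\kappa,a}(f)(y)=\int_{\mathbb R}B_{\kappa,a}(x,y)\,f(x)\,\frac{|x|^{2\kappa+a-2}}{2a^{\lambda}\Gamma(\lambda+1)}\,dx,\qquad y\in\mathbb R,$$ with kernel $$B_{\kappa,a}(x,y)=j_\lambda\Bigl(\tfrac2a|xy|^{a/2}\Bigr)+\frac{\Gamma(\lambda+1)}{\Gamma(\lambda+1+2/a)}\,\frac{xy}{(ai)^{2/a}}\,j_{\lambda+2/a}\Bigl(\tfrac2a|xy|^{a/2}\Bigr),\qquad (ai)^{2/a}=a^{2/a}e^{i\pi/a}.$$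 Here $\mathcal S(\mathbb R)$ is the space of complex-valued Schwartz functions, and a function $g:\mathbb R\to\mathbb C$ is called rapidly decreasing at infinity if $|y|^n|g(y)|\to0$ as $|y|\to\infty$ for every $n\in\mathbb N$. Then: (i) $\mathcal F_{\kappa,a}(f)\in C^\infty(\mathbb R)$ for every $f\in\mathcal S(\mathbb R)$ if and only if $\frac a2\in\mathbb N$; (ii) $\mathcal F_{\kappa,a}(f)$ is rapidly decreasing at infinity for every $f\in\mathcal S(\mathbb R)$ if and only if $\frac2a\in\mathbb N$. -/

import Mathlib

open scoped ContDiff SchwartzMap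

noncomputable section

namespace GenFourier

/-- The Bessel function of the first kind `J_ν(x)`, for real order `ν > -1` and `x > 0`. -/
def besselJ (ν x : ℝ) : ℝ :=
  ∑' n : ℕ, (-1) ^ n / ((n.factorial : ℝ) * Real.Gamma (n + ν + 1)) * (x / 2) ^ (2 * (n : ℝ) + ν)

/-- The normalized Bessel function `j_ν(x) = 2 ^ ν Γ(ν + 1) x ^ (-ν) J_ν(x)`, written as the even
entire power series in `x` that gives it at `x = 0` too (where `j_ν(0) = 1`). -/
def normBessel (ν x : ℝ) : ℝ :=
  Real.Gamma (ν + 1) *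
    ∑' n : ℕ, (-1) ^ n / ((n.factorial : ℝ) * Real.Gamma (n + ν + 1)) * (x / 2) ^ (2 * n)

theorem normBessel_eq_besselJ (ν : ℝ) {x : ℝ} (hx : 0 < x) :
    normBessel ν x = 2 ^ ν * Real.Gamma (ν + 1) * x ^ (-ν) * besselJ ν x := by
  have h2 : (0 : ℝ) < x / 2 := by positivity
  have key : besselJ ν x = (x / 2) ^ ν * ∑' n : ℕ,
      (-1) ^ n / ((n.factorial : ℝ) * Real.Gamma (n + ν + 1)) * (x / 2) ^ (2 * n) := by
    rw [besselJ, ← tsum_mul_left]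
    refine tsum_congr fun n => ?_
    rw [Real.rpow_add h2, ← Nat.cast_ofNat, ← Nat.cast_mul, Real.rpow_natCast]
    push_cast
    ring
  have h3 : (2 : ℝ) ^ ν * x ^ (-ν) * (x / 2) ^ ν = 1 := by
    rw [Real.div_rpow hx.le (by norm_num), Real.rpow_neg hx.le]
    have := (Real.rpow_pos_of_pos hx ν).ne'
    have := (Real.rpow_pos_of_pos (two_pos : (0 : ℝ) < 2) ν).ne'
    field_simp
  rw [key, normBessel]
  linear_combination (-(Real.Gamma (ν + 1) * ∑' n : ℕ,
      (-1) ^ n / ((n.factorial : ℝ) * Real.Gamma (n + ν + 1)) * (x / 2) ^ (2 * n))) * h3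

theorem normBessel_zero {ν : ℝ} (hν : -1 < ν) : normBessel ν 0 = 1 := by
  have hG : Real.Gamma (ν + 1) ≠ 0 := (Real.Gamma_pos_of_pos (by linarith)).ne'
  rw [normBessel, tsum_eq_single 0]
  · simp [hG]
  · intro n hn
    simp [hn]

/-- The index `λ_{κ,a} = 2 λ_κ / a`, where `λ_κ = κ - 1 / 2` in dimension one. -/
def index (κ a : ℝ) : ℝ := 2 * (κ - 1 / 2) / a

/-- The density with respect to Lebesgue measure on the real line of
`dμ_{κ,a}(x) = c_{κ,a} |x| ^ (2 κ + a - 2) dx`, where `1 / c_{κ,a} = 2 a ^ λ Γ(λ + 1)`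
and `λ = λ_{κ,a}`. -/
def density (κ a x : ℝ) : ℝ :=
  (2 * a ^ index κ a * Real.Gamma (index κ a + 1))⁻¹ * |x| ^ (2 * κ + a - 2)

/-- The kernel `B_{κ,a}(x, y)` of the one-dimensional `(κ,a)`-generalized Fourier transform. The
complex power is the principal one, so that `(a i) ^ (2 / a) = a ^ (2 / a) exp (π i / a)`. -/
def kernel (κ a x y : ℝ) : ℂ :=
  (normBessel (index κ a) (2 / a * |x * y| ^ (a / 2)) : ℂ) +
    (Real.Gamma (index κ a + 1) / Real.Gamma (index κ a + 1 + 2 / a) : ℝ) *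
      ((x * y : ℝ) / ((a : ℂ) * Complex.I) ^ ((2 / a : ℝ) : ℂ)) *
      (normBessel (index κ a + 2 / a) (2 / a * |x * y| ^ (a / 2)) : ℂ)

/-- The one-dimensional `(κ,a)`-generalized Fourier transform
`F_{κ,a}(f)(y) = ∫ B_{κ,a}(x, y) f(x) dμ_{κ,a}(x)`. -/
def transform (κ a : ℝ) (f : ℝ → ℂ) (y : ℝ) : ℂ :=
  ∫ x : ℝ, kernel κ a x y * f x * (density κ a x : ℂ)

/-- `g` is rapidly decreasing at infinity: `|y| ^ n |g(y)| → 0` as `|y| → ∞`, for every `n`. -/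
def RapidlyDecreasing (g : ℝ → ℂ) : Prop :=
  Asymptotics.SuperpolynomialDecay (Filter.cocompact ℝ) (fun y : ℝ => |y|) (fun y => ‖g y‖)

end GenFourier

end

namespace GenFourier

open Real Set Filter Topology MeasureTheory

/-! Put `w = |x|^a` and `s = |y|^a / a^2`. Both Bessel factors of the kernel then become entire
functions `E_ν(ws)` (`besselClifford`), and `exists_transform_eq_hankel` writes the transform as `A
H_λ[e(w^(1/a))](s) + B y H_(λ+2/a)[g(w^(1/a))](s)`. Here `H_ν h(s) = ∫ E_ν(ws) w^ν h(w) dw` over `w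
> 0`, and `e`, `g` are even Schwartz functions with `f(x) + f(-x) = e(x)` and `f(x) - f(-x) = x
g(x)`.

Sufficiency. If `a = 2n`, then `s` is a polynomial in `y`, and differentiation under the integral,
by `E_ν' = -E_(ν+1)`, never leaves the family `H_ν` (`HalfLineRapid.contDiff_hankel_comp`). If `2/a
= m`, then `H_ν h = -H_(ν+1) h'` (`HalfLineRapid.hankel_parts`) can be iterated. The functions `w^j
g(w^(m/2))` with `g` even are stable under differentiation up to linear combinations, because `g'(x)
= x d(x)` with `d` even. Once the order is large, `r^k E_ν(r)` is bounded, which gives decay of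
order `k` in `s` (`exists_pow_mul_norm_hankel_comp_rpow_le`).

Necessity. Both directions test `f(x) = x^2 χ(x)`, with `χ` an even bump, so that `h(w) = w^(2/a)
χ(w^(1/a))`. For smoothness, `H_λ h` has a nonzero one-sided derivative at 0, so the transform minus
its value at 0 is asymptotic to `c y^a`; a Taylor polynomial and the evenness of the transform make
`a` an even integer. For decay, the Laplace transform of `s^ν H_ν h(s)` is `∫ v^ν e^(-v) h(pv) dv`,
asymptotic to a nonzero multiple of `p^(2/a)` as `p → 0+`. Rapid decay of `H_ν h` would give it
Taylor polynomials of every order there, so `2/a` is an integer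
(`HalfLineRapid.exists_eq_natCast_of_hankel_decay`). Both arguments end in
`exists_eq_natCast_of_tendsto_polynomial`. -/

/-! ### Bessel-Clifford functions: recurrences, bounds and Laplace transform. -/

/-- The coefficients of the Bessel-Clifford function. -/
noncomputable def cliffordCoeff (ν : ℝ) (n : ℕ) : ℝ :=
  (-1) ^ n / ((n.factorial : ℝ) * Gamma (n + ν + 1))

/-- The entire function `E_ν` with `normBessel ν x = Γ(ν + 1) E_ν(x ^ 2 / 4)`. -/
noncomputable def besselClifford (ν r : ℝ) : ℝ := ∑' n : ℕ, cliffordCoeff ν n * r ^ n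

theorem normBessel_eq_besselClifford (ν x : ℝ) :
    normBessel ν x = Gamma (ν + 1) * besselClifford ν ((x / 2) ^ 2) := by
  simp only [normBessel, besselClifford, cliffordCoeff, pow_mul]

theorem gamma_arg_pos {ν : ℝ} (hν : -1 < ν) (n : ℕ) : 0 < n + ν + 1 := by
  have : (0 : ℝ) ≤ n := n.cast_nonneg
  linarith

theorem cliffordCoeff_ne_zero {ν : ℝ} (hν : -1 < ν) (n : ℕ) : cliffordCoeff ν n ≠ 0 := by
  have := Gamma_pos_of_pos (gamma_arg_pos hν n)
  unfold cliffordCoeff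
  positivity

theorem cliffordCoeff_succ {ν : ℝ} (hν : -1 < ν) (n : ℕ) :
    cliffordCoeff ν (n + 1) = -cliffordCoeff ν n / ((n + 1) * (n + ν + 1)) := by
  have h0 := gamma_arg_pos hν n
  have h1 := Gamma_pos_of_pos h0
  have h2 : Gamma (((n + 1 : ℕ) : ℝ) + ν + 1) = (n + ν + 1) * Gamma (n + ν + 1) := by
    rw [← Gamma_add_one h0.ne']
    congr 1
    push_cast
    ring
  have h3 : ((n : ℝ) + 1) ≠ 0 := by positivity
  unfold cliffordCoeff
  rw [h2, Nat.factorial_succ, pow_succ]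
  push_cast
  have h4 : (n.factorial : ℝ) ≠ 0 := by positivity
  field_simp

theorem succ_mul_cliffordCoeff {ν : ℝ} (n : ℕ) :
    (n + 1) * cliffordCoeff ν (n + 1) = -cliffordCoeff (ν + 1) n := by
  have h2 : Gamma (((n + 1 : ℕ) : ℝ) + ν + 1) = Gamma (n + (ν + 1) + 1) := by
    congr 1
    push_cast
    ring
  have h3 : ((n : ℝ) + 1) ≠ 0 := by positivity
  unfold cliffordCoeff
  rw [h2, Nat.factorial_succ, pow_succ]
  push_cast
  have h4 : (n.factorial : ℝ) ≠ 0 := by positivity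
  -- The order is unrestricted here; where `Gamma` takes the value 0, both sides vanish by the
  -- convention for division by zero.
  by_cases h5 : Gamma (n + (ν + 1) + 1) = 0
  · simp [h5]
  field_simp

theorem cliffordCoeff_eq {ν : ℝ} (hν : -1 < ν) (n : ℕ) :
    cliffordCoeff ν n = (n + ν + 1) * cliffordCoeff (ν + 1) n := by
  have h0 := gamma_arg_pos hν n
  have h1 := Gamma_pos_of_pos h0
  have h2 : Gamma (n + (ν + 1) + 1) = (n + ν + 1) * Gamma (n + ν + 1) := by
    rw [← Gamma_add_one h0.ne']
    congr 1
    ring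
  unfold cliffordCoeff
  rw [h2]
  have h4 : (n.factorial : ℝ) ≠ 0 := by positivity
  field_simp

theorem summable_cliffordCoeff {ν : ℝ} (hν : -1 < ν) (r : ℝ) :
    Summable fun n => |cliffordCoeff ν n * r ^ n| := by
  by_cases hr : r = 0
  · subst hr
    refine summable_of_ne_finset_zero (s := {0}) fun n hn => ?_
    have : n ≠ 0 := by simpa using hn
    simp [this]
  refine summable_of_ratio_test_tendsto_lt_one (l := 0) zero_lt_one
    (Eventually.of_forall fun n => ?_) ?_
  · exact abs_ne_zero.2 (mul_ne_zero (cliffordCoeff_ne_zero hν n) (pow_ne_zero _ hr))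
  · have h : ∀ n : ℕ, ‖|cliffordCoeff ν (n + 1) * r ^ (n + 1)|‖ / ‖|cliffordCoeff ν n * r ^ n|‖ =
        |r| * (((n : ℝ) + 1)⁻¹ * (n + (ν + 1))⁻¹) := fun n => by
      have h0 := gamma_arg_pos hν n
      have h1 : (0 : ℝ) < n + 1 := by positivity
      have h2 := abs_ne_zero.2 (cliffordCoeff_ne_zero hν n)
      have h3 := abs_ne_zero.2 (pow_ne_zero n hr)
      rw [cliffordCoeff_succ hν, pow_succ]
      simp only [norm_eq_abs, abs_abs, abs_mul, abs_div, abs_neg, abs_of_pos h0, abs_of_pos h1]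
      rw [← add_assoc]
      field_simp
    simp_rw [h]
    have e1 : Tendsto (fun n : ℕ => ((n : ℝ) + 1)⁻¹) atTop (𝓝 0) :=
      (tendsto_natCast_atTop_atTop.atTop_add tendsto_const_nhds).inv_tendsto_atTop
    have e2 : Tendsto (fun n : ℕ => ((n : ℝ) + (ν + 1))⁻¹) atTop (𝓝 0) :=
      (tendsto_natCast_atTop_atTop.atTop_add tendsto_const_nhds).inv_tendsto_atTop
    simpa using (e1.mul e2).const_mul |r|

theorem hasSum_besselClifford {ν : ℝ} (hν : -1 < ν) (r : ℝ) :
    HasSum (fun n => cliffordCoeff ν n * r ^ n) (besselClifford ν r) :=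
  (summable_cliffordCoeff hν r).of_abs.hasSum

theorem besselClifford_zero (ν : ℝ) : besselClifford ν 0 = (Gamma (ν + 1))⁻¹ := by
  rw [besselClifford, tsum_eq_single 0]
  · simp [cliffordCoeff]
  · intro n hn
    simp [hn]

theorem besselClifford_zero_pos {ν : ℝ} (hν : -1 < ν) : 0 < besselClifford ν 0 := by
  rw [besselClifford_zero]
  exact inv_pos.2 (Gamma_pos_of_pos (by linarith))

theorem hasDerivAt_besselClifford {ν : ℝ} (hν : -1 < ν) (r : ℝ) :
    HasDerivAt (besselClifford ν) (-besselClifford (ν + 1) r) r := by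
  have hν' : -1 < ν + 1 := by linarith
  set R := |r| + 1
  have hR : 0 < R := by positivity
  have hderiv : ∀ (n : ℕ) (y : ℝ), HasDerivAt (fun y => cliffordCoeff ν n * y ^ n)
      (cliffordCoeff ν n * (n * y ^ (n - 1))) y := fun n y => (hasDerivAt_pow n y).const_mul _
  have hshift : ∀ (n : ℕ) (y : ℝ), cliffordCoeff ν (n + 1) * ((n + 1 : ℕ) * y ^ (n + 1 - 1)) =
      -(cliffordCoeff (ν + 1) n * y ^ n) := fun n y => by
    have := succ_mul_cliffordCoeff (ν := ν) n
    push_cast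
    linear_combination y ^ n * this
  have hu : Summable fun n => |cliffordCoeff ν n * (n * R ^ (n - 1))| := by
    refine (summable_nat_add_iff 1).1 ?_
    simp_rw [hshift, abs_neg]
    exact summable_cliffordCoeff hν' R
  have hmem : ∀ y, y ∈ Ioo (-R) R ↔ |y| < R := fun y => abs_lt.symm
  have key := hasDerivAt_tsum_of_isPreconnected (𝕜 := ℝ) hu isOpen_Ioo isPreconnected_Ioo
    (t := Ioo (-R) R) (fun n y _ => hderiv n y) (fun n y hy => ?_) (y₀ := 0) (y := r)
    ⟨by linarith, hR⟩ (summable_cliffordCoeff hν 0).of_abs ((hmem r).2 (lt_add_one _))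
  · convert! key using 1
    have hs : Summable fun n => cliffordCoeff ν n * (n * r ^ (n - 1)) := by
      refine (summable_nat_add_iff 1).1 ?_
      simp_rw [hshift]
      exact (summable_cliffordCoeff hν' r).of_abs.neg
    rw [hs.tsum_eq_zero_add]
    simp_rw [hshift]
    rw [tsum_neg]
    simp [besselClifford]
  · have := ((hmem y).1 hy).le
    simp only [norm_eq_abs, abs_mul, abs_pow, abs_of_pos hR]
    gcongr

theorem continuous_besselClifford {ν : ℝ} (hν : -1 < ν) : Continuous (besselClifford ν) :=
  continuous_iff_continuousAt.2 fun r => (hasDerivAt_besselClifford hν r).continuousAt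

/-- In `cliffordCoeff_eq` split the factor `n + ν + 1`: the part `ν + 1` gives the first term, and
the part `n` lowers the factorial and shifts the series to order `ν + 2`. -/
theorem besselClifford_recurrence {ν : ℝ} (hν : -1 < ν) (r : ℝ) :
    besselClifford ν r = (ν + 1) * besselClifford (ν + 1) r - r * besselClifford (ν + 2) r := by
  have h0 := hasSum_besselClifford hν r
  have h1 := (hasSum_besselClifford (show -1 < ν + 1 by linarith) r).mul_left (ν + 1)
  have h2 := (hasSum_besselClifford (show -1 < ν + 2 by linarith) r).mul_left (-r)
  have h3 : HasSum (fun n : ℕ => (n * cliffordCoeff (ν + 1) n) * r ^ n)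
      (-r * besselClifford (ν + 2) r) := by
    rw [← hasSum_nat_add_iff' 1]
    simp only [Finset.range_one, Finset.sum_singleton, Nat.cast_zero, zero_mul, sub_zero]
    refine h2.congr_fun fun n => ?_
    have := succ_mul_cliffordCoeff (ν := ν + 1) n
    rw [show ν + 1 + 1 = ν + 2 by ring] at this
    push_cast
    linear_combination r ^ (n + 1) * this
  refine h0.unique (((h1.add h3).congr_fun fun n => ?_).trans_eq ?_)
  · rw [cliffordCoeff_eq hν]; ring
  · rw [neg_mul, sub_eq_add_neg]

/-- The analogue of `(x^(ν+1) J_(ν+1))' = x^(ν+1) J_ν`: it supplies the antiderivative used to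
integrate Hankel transforms by parts. -/
theorem hasDerivAt_rpow_mul_besselClifford {ν : ℝ} (hν : -1 < ν) (s : ℝ) {w : ℝ} (hw : 0 < w) :
    HasDerivAt (fun w => w ^ (ν + 1) * besselClifford (ν + 1) (w * s))
      (w ^ ν * besselClifford ν (w * s)) w := by
  have h1 : HasDerivAt (fun w : ℝ => w ^ (ν + 1)) ((ν + 1) * w ^ (ν + 1 - 1)) w :=
    hasDerivAt_rpow_const (Or.inl hw.ne')
  have h2 : HasDerivAt (fun w : ℝ => besselClifford (ν + 1) (w * s))
      (-besselClifford (ν + 1 + 1) (w * s) * s) w :=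
    HasDerivAt.comp (h := fun w => w * s) w
      (hasDerivAt_besselClifford (show -1 < ν + 1 by linarith) (w * s)) (hasDerivAt_mul_const s)
  refine (h1.mul h2).congr_deriv ?_
  rw [besselClifford_recurrence hν, rpow_add hw, rpow_one, add_sub_cancel_right,
    show ν + 1 + 1 = ν + 2 by ring]
  ring

/-- An energy argument: by the recurrence, `E_ν^2 + r E_(ν+1)^2` has derivative `-(2ν+1) E_(ν+1)^2`,
nonpositive exactly because of the restriction on `ν`. -/
theorem abs_besselClifford_le {ν : ℝ} (hν : -(1 / 2) ≤ ν) {r : ℝ} (hr : 0 ≤ r) :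
    |besselClifford ν r| ≤ besselClifford ν 0 := by
  have hν1 : -1 < ν := by linarith
  have hd : ∀ r, HasDerivAt (fun r => besselClifford ν r ^ 2 + r * besselClifford (ν + 1) r ^ 2)
      (-(2 * ν + 1) * besselClifford (ν + 1) r ^ 2) r := fun r => by
    have h0 := hasDerivAt_besselClifford hν1 r
    have h1 := hasDerivAt_besselClifford (show -1 < ν + 1 by linarith) r
    refine ((h0.pow 2).add ((hasDerivAt_id r).mul (h1.pow 2))).congr_deriv ?_
    have := besselClifford_recurrence hν1 r
    rw [show ν + 1 + 1 = ν + 2 by ring]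
    simp only [id, Pi.pow_apply]
    push_cast
    linear_combination (-2 * besselClifford (ν + 1) r) * this
  have hanti : Antitone fun r => besselClifford ν r ^ 2 + r * besselClifford (ν + 1) r ^ 2 := by
    refine antitone_of_deriv_nonpos (fun r => (hd r).differentiableAt) fun r => ?_
    rw [(hd r).deriv]
    nlinarith [sq_nonneg (besselClifford (ν + 1) r)]
  have h := hanti hr
  simp only [zero_mul, add_zero] at h
  refine abs_le_of_sq_le_sq (le_trans ?_ h) (besselClifford_zero_pos hν1).le
  have := mul_nonneg hr (sq_nonneg (besselClifford (ν + 1) r))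
  linarith

/-- Below order `-1/2` the energy bound is not available; the recurrence passes to orders `ν + 1`
and `ν + 2`, at the cost of one factor `r`. -/
theorem exists_abs_besselClifford_le {ν : ℝ} (hν : -1 < ν) :
    ∃ C, 0 < C ∧ ∀ r, 0 ≤ r → |besselClifford ν r| ≤ C * (1 + r) := by
  refine ⟨(ν + 1) * besselClifford (ν + 1) 0 + besselClifford (ν + 2) 0, ?_, fun r hr => ?_⟩
  · have h1 := besselClifford_zero_pos (show -1 < ν + 1 by linarith)
    have h2 := besselClifford_zero_pos (show -1 < ν + 2 by linarith)
    have : 0 < ν + 1 := by linarith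
    positivity
  have h1 := abs_besselClifford_le (show -(1 / 2) ≤ ν + 1 by linarith) hr
  have h2 := abs_besselClifford_le (show -(1 / 2) ≤ ν + 2 by linarith) hr
  have h10 := (abs_nonneg _).trans h1
  have h20 := (abs_nonneg _).trans h2
  have h0 : 0 < ν + 1 := by linarith
  rw [besselClifford_recurrence hν]
  calc _ ≤ |(ν + 1) * besselClifford (ν + 1) r| + |r * besselClifford (ν + 2) r| := abs_sub _ _
    _ = (ν + 1) * |besselClifford (ν + 1) r| + r * |besselClifford (ν + 2) r| := by
      rw [abs_mul, abs_mul, abs_of_pos h0, abs_of_nonneg hr]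
    _ ≤ (ν + 1) * besselClifford (ν + 1) 0 + r * besselClifford (ν + 2) 0 := by gcongr
    _ ≤ _ := by
      have := mul_nonneg (mul_nonneg h0.le h10) hr
      nlinarith

/-- Read backwards, the recurrence is `r E_ν = (ν-1) E_(ν-1) - E_(ν-2)`: each power of `r` costs at
most two orders, down to the energy bound at `k = 0`. -/
theorem exists_pow_mul_abs_besselClifford_le (k : ℕ) : ∀ {ν : ℝ}, 2 * (k : ℝ) - 1 / 2 ≤ ν →
    ∃ C, ∀ r, 0 ≤ r → r ^ k * |besselClifford ν r| ≤ C := by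
  induction k with
  | zero =>
    intro ν hν
    refine ⟨besselClifford ν 0, fun r hr => ?_⟩
    simpa using abs_besselClifford_le (by simpa using hν) hr
  | succ k ih =>
    intro ν hν
    push_cast at hν
    have hk : (0 : ℝ) ≤ k := k.cast_nonneg
    obtain ⟨C₁, h1⟩ := ih (ν := ν - 1) (by linarith)
    obtain ⟨C₂, h2⟩ := ih (ν := ν - 2) (by linarith)
    refine ⟨(ν - 1) * C₁ + C₂, fun r hr => ?_⟩
    have hrec := besselClifford_recurrence (show -1 < ν - 2 by linarith) r
    rw [show ν - 2 + 1 = ν - 1 by ring, show ν - 2 + 2 = ν by ring] at hrec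
    have h0 : 0 ≤ ν - 1 := by linarith
    calc _ = r ^ k * |r * besselClifford ν r| := by
          rw [abs_mul, abs_of_nonneg hr]; ring
      _ = r ^ k * |(ν - 1) * besselClifford (ν - 1) r - besselClifford (ν - 2) r| := by
          congr 2; linarith
      _ ≤ r ^ k * (|(ν - 1) * besselClifford (ν - 1) r| + |besselClifford (ν - 2) r|) := by
          gcongr; exact abs_sub _ _
      _ = (ν - 1) * (r ^ k * |besselClifford (ν - 1) r|) +
          r ^ k * |besselClifford (ν - 2) r| := by
          rw [abs_mul, abs_of_nonneg h0]; ring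
      _ ≤ _ := by
          gcongr
          exacts [h1 r hr, h2 r hr]

theorem abs_besselClifford_sub_le {ν : ℝ} (hν : -1 < ν) {r : ℝ} (hr : 0 ≤ r) :
    |besselClifford ν r - besselClifford ν 0| ≤ besselClifford (ν + 1) 0 * r := by
  have := (convex_Ici (0 : ℝ)).norm_image_sub_le_of_norm_hasDerivWithin_le
    (f := besselClifford ν) (fun x _ => (hasDerivAt_besselClifford hν x).hasDerivWithinAt)
    (fun x hx => by
      rw [norm_neg]
      exact abs_besselClifford_le (by linarith) hx) (mem_Ici.2 le_rfl) (mem_Ici.2 hr)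
  simpa [abs_of_nonneg hr] using this

/-- Integrating the series term by term, each Gamma integral cancels the Gamma factor of its
coefficient, and the exponential series remains. -/
theorem integral_besselClifford_mul_exp {ν : ℝ} (hν : -1 < ν) (w : ℝ) {p : ℝ} (hp : 0 < p) :
    ∫ s in Ioi (0 : ℝ), besselClifford ν (w * s) * (s ^ ν * exp (-(p * s))) =
      (1 / p) ^ (ν + 1) * exp (-(w / p)) := by
  have hν1 : 0 < ν + 1 := by linarith
  have hint : ∀ n : ℕ, ∫ s in Ioi (0 : ℝ), s ^ (n + ν) * exp (-(p * s)) =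
      (1 / p) ^ (n + ν + 1) * Gamma (n + ν + 1) := fun n => by
    rw [← integral_rpow_mul_exp_neg_mul_Ioi (gamma_arg_pos hν n) hp]
    simp
  have hI : ∀ n : ℕ, IntegrableOn (fun s : ℝ => s ^ (n + ν) * exp (-(p * s))) (Ioi 0) :=
    fun n => by
      -- A nonintegrable function would have integral 0 by convention, whereas `hint` gives a
      -- positive value.
      by_contra h
      have h1 := hint n
      rw [integral_undef h] at h1
      have := Gamma_pos_of_pos (gamma_arg_pos hν n)
      have : 0 < (1 / p) ^ (n + ν + 1) * Gamma (n + ν + 1) := by positivity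
      linarith
  set F : ℕ → ℝ → ℝ := fun n s => cliffordCoeff ν n * w ^ n * (s ^ (n + ν) * exp (-(p * s)))
  have hFint : ∀ n, ∫ s in Ioi (0 : ℝ), F n s =
      (1 / p) ^ (ν + 1) * ((-(w / p)) ^ n / n.factorial) := fun n => by
    have h0 := (Gamma_pos_of_pos (gamma_arg_pos hν n)).ne'
    have h1 : (n.factorial : ℝ) ≠ 0 := by positivity
    simp only [F]
    rw [integral_const_mul, hint, add_assoc, rpow_add (by positivity), rpow_natCast, cliffordCoeff,
      neg_pow (w / p), div_pow, div_pow]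
    rw [← add_assoc]
    field_simp
    simp
  have hFnorm : ∀ n, ∫ s in Ioi (0 : ℝ), ‖F n s‖ =
      (1 / p) ^ (ν + 1) * ((|w| / p) ^ n / n.factorial) := fun n => by
    have h0 := (Gamma_pos_of_pos (gamma_arg_pos hν n))
    have h1 : (n.factorial : ℝ) ≠ 0 := by positivity
    have : ∫ s in Ioi (0 : ℝ), ‖F n s‖ = ∫ s in Ioi (0 : ℝ), |cliffordCoeff ν n * w ^ n| *
        (s ^ (n + ν) * exp (-(p * s))) := by
      refine setIntegral_congr_fun measurableSet_Ioi fun s hs => ?_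
      have : 0 ≤ s ^ (n + ν) := rpow_nonneg (le_of_lt hs) _
      simp only [F, norm_mul, norm_eq_abs, abs_mul, abs_of_nonneg this, abs_exp]
    rw [this, integral_const_mul, hint, add_assoc, rpow_add (by positivity), rpow_natCast,
      cliffordCoeff, abs_mul, abs_div, abs_pow, abs_mul, abs_of_pos h0, abs_pow, div_pow, div_pow]
    rw [← add_assoc]
    simp
    field_simp
  have hsum := hasSum_integral_of_summable_integral_norm (μ := volume.restrict (Ioi 0)) (F := F)
    (fun n => (hI n).const_mul _) (by
      simp_rw [hFnorm]
      exact (summable_pow_div_factorial _).mul_left _)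
  have h1 : ∀ s ∈ Ioi (0 : ℝ), ∑' n, F n s =
      besselClifford ν (w * s) * (s ^ ν * exp (-(p * s))) := fun s hs => by
    rw [besselClifford, ← tsum_mul_right]
    refine tsum_congr fun n => ?_
    simp only [F]
    rw [rpow_add hs, rpow_natCast, mul_pow]
    ring
  rw [setIntegral_congr_fun measurableSet_Ioi h1] at hsum
  refine hsum.unique ?_
  simp_rw [hFint]
  refine HasSum.mul_left _ ?_
  rw [exp_eq_exp_ℝ]
  exact NormedSpace.exp_series_hasSum_exp' (𝕂 := ℝ) (-(w / p)) |>.congr_fun fun n => by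
    simp [div_eq_inv_mul]

/-! ### Polynomial asymptotics at the origin. -/

/-- A polynomial can be asymptotic to `c₀ + c₁ p ^ β` at `0⁺` only if `β` is an integer. -/
theorem exists_eq_natCast_of_tendsto_polynomial (Q : Polynomial ℂ) {c₀ c₁ : ℂ} (hc : c₁ ≠ 0)
    {β : ℝ} (hβ : 0 < β)
    (h : Tendsto (fun p : ℝ => (Q.eval (p : ℂ) - c₀) / ((p ^ β : ℝ) : ℂ)) (𝓝[>] 0) (𝓝 c₁)) :
    ∃ n : ℕ, β = n ∧ Q.coeff n = c₁ := by
  set R := Q - Polynomial.C c₀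
  have hR : ∀ p : ℝ, Q.eval (p : ℂ) - c₀ = R.eval (p : ℂ) := fun p => by simp [R]
  simp_rw [hR] at h
  have hR0 : R ≠ 0 := fun h0 => by
    simp only [h0, Polynomial.eval_zero, zero_div] at h
    exact hc (tendsto_nhds_unique h tendsto_const_nhds)
  -- Write `R = X^n S` with `S(0) ≠ 0`. Then `p^(n-β)` has the nonzero finite limit `c₁ / S(0)`,
  -- which forces `n = β`.
  obtain ⟨S, hS, hdvd⟩ := R.exists_eq_pow_rootMultiplicity_mul_and_not_dvd hR0 0
  set n := R.rootMultiplicity 0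
  rw [Polynomial.C_0, sub_zero] at hS hdvd
  have hd : S.eval 0 ≠ 0 := fun h0 => hdvd (Polynomial.X_dvd_iff.2 (by
    rwa [Polynomial.coeff_zero_eq_eval_zero]))
  have hSlim : Tendsto (fun p : ℝ => S.eval (p : ℂ)) (𝓝[>] 0) (𝓝 (S.eval 0)) := by
    have : Continuous fun p : ℝ => S.eval (p : ℂ) :=
      S.continuous.comp Complex.continuous_ofReal
    simpa using (this.tendsto 0).mono_left nhdsWithin_le_nhds
  have hpow : Tendsto (fun p : ℝ => ((p ^ ((n : ℝ) - β) : ℝ) : ℂ)) (𝓝[>] 0)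
      (𝓝 (c₁ / S.eval 0)) := by
    refine (h.div hSlim hd).congr' ?_
    filter_upwards [self_mem_nhdsWithin, hSlim.eventually_ne hd] with p hp hne
    have h1 : ((p ^ β : ℝ) : ℂ) ≠ 0 := by
      exact_mod_cast (rpow_pos_of_pos hp β).ne'
    rw [hS, rpow_sub hp, rpow_natCast]
    simp only [Pi.div_apply, Polynomial.eval_mul, Polynomial.eval_pow, Polynomial.eval_X]
    push_cast
    field_simp
  have hq : c₁ / S.eval 0 ≠ 0 := div_ne_zero hc hd
  have hnorm : Tendsto (fun p : ℝ => p ^ ((n : ℝ) - β)) (𝓝[>] 0) (𝓝 ‖c₁ / S.eval 0‖) := by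
    refine hpow.norm.congr' ?_
    filter_upwards [self_mem_nhdsWithin] with p hp
    rw [Complex.norm_real, norm_eq_abs, abs_of_pos (rpow_pos_of_pos hp _)]
  have hn : β = n := by
    rcases lt_trichotomy (n : ℝ) β with hlt | heq | hgt
    · have h1 : Tendsto (fun p : ℝ => p ^ ((n : ℝ) - β)) (𝓝[>] 0) atTop :=
        tendsto_rpow_neg_nhdsGT_zero (by linarith)
      exact absurd hnorm (not_tendsto_nhds_of_tendsto_atTop h1 _)
    · exact heq.symm
    · have h1 : Tendsto (fun p : ℝ => p ^ ((n : ℝ) - β)) (𝓝[>] 0) (𝓝 0) := by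
        have h2 : (0 : ℝ) < n - β := by linarith
        have := (continuous_rpow_const h2.le).tendsto 0
        rw [zero_rpow h2.ne'] at this
        exact this.mono_left nhdsWithin_le_nhds
      exact absurd (tendsto_nhds_unique hnorm h1) (norm_ne_zero_iff.2 hq)
  refine ⟨n, hn, ?_⟩
  -- Since `β > 0`, subtracting the constant `c₀` does not affect the coefficient in question.
  have hn0 : n ≠ 0 := fun h0 => by rw [h0] at hn; simp at hn; linarith
  have h1 : Q.coeff n = R.coeff n := by
    simp [R, Polynomial.coeff_C, hn0]
  rw [h1, hS, Polynomial.coeff_X_pow_mul' , if_pos le_rfl, Nat.sub_self,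
    Polynomial.coeff_zero_eq_eval_zero]
  have h2 : c₁ / S.eval 0 = 1 := by
    refine tendsto_nhds_unique hpow ?_
    simp [hn]
  rw [div_eq_one_iff_eq hd] at h2
  exact h2.symm

theorem exists_polynomial_isLittleO {g : ℝ → ℂ} (hg : ContDiff ℝ ∞ g) (N : ℕ) :
    ∃ Q : Polynomial ℂ, (fun y : ℝ => g y - Q.eval (y : ℂ)) =o[𝓝 0] fun y => y ^ N := by
  refine ⟨∑ k ∈ Finset.range (N + 1), Polynomial.C (((k.factorial : ℝ)⁻¹ : ℝ) *
    iteratedDerivWithin k g univ 0) * Polynomial.X ^ k, ?_⟩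
  have h := taylor_isLittleO_univ (x₀ := 0) (n := N) (hg.of_le (mod_cast le_top))
  simp only [sub_zero] at h
  refine h.congr_left fun y => ?_
  rw [taylor_within_apply, Polynomial.eval_finsetSum]
  congr 1
  refine Finset.sum_congr rfl fun k _ => ?_
  simp
  ring

/-! ### Division of Schwartz functions by `x`. -/

/-- The weight `t^k` closes the induction: one derivative in `y` replaces `φ` by `φ'` and `k` by `k
+ 1`. -/
theorem contDiff_integral_comp_mul (φ : 𝓢(ℝ, ℂ)) (n k : ℕ) :
    ContDiff ℝ n fun y : ℝ => ∫ t in (0 : ℝ)..1, (t : ℂ) ^ k * φ (t * y) := by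
  have hd : ∀ (φ : 𝓢(ℝ, ℂ)) (k : ℕ) (y : ℝ),
      HasDerivAt (fun y : ℝ => ∫ t in (0 : ℝ)..1, (t : ℂ) ^ k * φ (t * y))
        (∫ t in (0 : ℝ)..1, (t : ℂ) ^ (k + 1) * (SchwartzMap.derivCLM ℂ ℂ φ) (t * y)) y := by
    intro φ k y
    set ψ := SchwartzMap.derivCLM ℂ ℂ φ
    have hc : ∀ (φ : 𝓢(ℝ, ℂ)) (k : ℕ) (y : ℝ),
        Continuous fun t : ℝ => (t : ℂ) ^ k * φ (t * y) := fun φ k y => by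
      have := φ.continuous
      fun_prop
    refine (intervalIntegral.hasDerivAt_integral_of_dominated_loc_of_deriv_le (μ := volume)
      (F := fun (y t : ℝ) => (t : ℂ) ^ k * φ (t * y))
      (F' := fun (y t : ℝ) => (t : ℂ) ^ (k + 1) * ψ (t * y))
      (bound := fun _ => SchwartzMap.seminorm ℝ 0 0 ψ) univ_mem
      (Eventually.of_forall fun y => (hc φ k y).aestronglyMeasurable)
      ((hc φ k y).intervalIntegrable _ _) (hc ψ (k + 1) y).aestronglyMeasurable
      (Eventually.of_forall fun t ht y _ => ?_) intervalIntegrable_const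
      (Eventually.of_forall fun t ht y _ => ?_)).2
    · rw [uIoc_of_le zero_le_one] at ht
      rw [norm_mul, norm_pow, Complex.norm_real, norm_eq_abs, abs_of_pos ht.1]
      calc _ ≤ 1 * ‖ψ (t * y)‖ := by
            gcongr
            exact pow_le_one₀ ht.1.le ht.2
        _ ≤ _ := by
            rw [one_mul]
            exact SchwartzMap.norm_le_seminorm ℝ ψ _
    · have h1 : HasDerivAt (fun y : ℝ => φ (t * y)) (t • ψ (t * y)) y :=
        HasDerivAt.scomp (h := fun y => t * y) y (φ.hasDerivAt (t * y))
          (hasDerivAt_const_mul t)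
      refine (h1.const_mul ((t : ℂ) ^ k)).congr_deriv ?_
      rw [Complex.real_smul]
      ring
  induction n generalizing φ k with
  | zero =>
    exact contDiff_zero.2 (continuous_iff_continuousAt.2 fun y => (hd φ k y).continuousAt)
  | succ n ih =>
    push_cast
    rw [contDiff_succ_iff_deriv]
    refine ⟨fun y => (hd φ k y).differentiableAt, by simp, ?_⟩
    have : deriv (fun y : ℝ => ∫ t in (0 : ℝ)..1, (t : ℂ) ^ k * φ (t * y)) = fun y =>
        ∫ t in (0 : ℝ)..1, (t : ℂ) ^ (k + 1) * (SchwartzMap.derivCLM ℂ ℂ φ) (t * y) :=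
      funext fun y => (hd φ k y).deriv
    rw [this]
    exact ih _ _

theorem iteratedDeriv_succ_ofReal_mul {g : ℝ → ℂ} (hg : ContDiff ℝ ∞ g) (n : ℕ) :
    iteratedDeriv (n + 1) (fun x : ℝ => (x : ℂ) * g x) = fun x : ℝ =>
      (x : ℂ) * iteratedDeriv (n + 1) g x + (n + 1) * iteratedDeriv n g x := by
  have hd : ∀ (m : ℕ) (x : ℝ), HasDerivAt (iteratedDeriv m g) (iteratedDeriv (m + 1) g x) x :=
    fun m x => by
      rw [iteratedDeriv_succ]
      exact (hg.differentiable_iteratedDeriv m (mod_cast WithTop.coe_lt_top m) x).hasDerivAt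
  have hx : ∀ x : ℝ, HasDerivAt (fun x : ℝ => (x : ℂ)) 1 x := fun x =>
    Complex.ofRealCLM.hasDerivAt
  induction n with
  | zero =>
    funext x
    rw [iteratedDeriv_succ, iteratedDeriv_zero]
    have h0 := hd 0 x
    rw [iteratedDeriv_zero] at h0
    refine ((hx x).mul h0).deriv.trans ?_
    simp
    ring
  | succ n ih =>
    funext x
    rw [iteratedDeriv_succ, ih]
    refine (((hx x).mul (hd (n + 1) x)).add ((hd n x).const_mul ((n : ℂ) + 1))).deriv.trans ?_
    push_cast
    ring

/-- A Schwartz function vanishing at the origin is `x` times a Schwartz function. -/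
theorem exists_schwartzMap_eq_ofReal_mul (q : 𝓢(ℝ, ℂ)) (hq : q 0 = 0) :
    ∃ g : 𝓢(ℝ, ℂ), ∀ x : ℝ, q x = x * g x := by
  -- Hadamard's formula for the quotient, which makes its smoothness at 0 visible.
  set g : ℝ → ℂ := fun y => ∫ t in (0 : ℝ)..1, (SchwartzMap.derivCLM ℂ ℂ q) (t * y)
  have hg : ContDiff ℝ ∞ g := contDiff_infty.2 fun n => by
    simpa only [pow_zero, one_mul] using contDiff_integral_comp_mul (SchwartzMap.derivCLM ℂ ℂ q) n 0
  have hqg : ∀ x : ℝ, q x = x * g x := fun x => by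
    have h1 : ∀ t ∈ uIcc (0 : ℝ) 1, HasDerivAt (fun t : ℝ => q (t * x))
        (x • (SchwartzMap.derivCLM ℂ ℂ q) (t * x)) t := fun t _ =>
      HasDerivAt.scomp (h := fun t => t * x) t (q.hasDerivAt (t * x)) (hasDerivAt_mul_const x)
    have h2 := intervalIntegral.integral_eq_sub_of_hasDerivAt h1
      (Continuous.intervalIntegrable (by
        have := (SchwartzMap.derivCLM ℂ ℂ q).continuous
        fun_prop) _ _)
    rw [intervalIntegral.integral_smul] at h2
    simp only [one_mul, zero_mul, hq, sub_zero, Complex.real_smul] at h2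
    exact h2.symm
  have hfun : (q : ℝ → ℂ) = fun x : ℝ => (x : ℂ) * g x := funext hqg
  have hdecay : ∀ n k : ℕ, ∃ C : ℝ, ∀ x : ℝ, |x| ^ k * ‖iteratedDeriv n g x‖ ≤ C := by
    -- Control of `q = x g` bounds derivatives of `g` only with at least one factor `|x|`;
    -- continuity on `[-1, 1]` removes that factor.
    have hone : ∀ n : ℕ, (∀ k : ℕ, ∃ C : ℝ, ∀ x : ℝ, |x| ^ (k + 1) * ‖iteratedDeriv n g x‖ ≤ C) →
        ∀ k : ℕ, ∃ C : ℝ, ∀ x : ℝ, |x| ^ k * ‖iteratedDeriv n g x‖ ≤ C := by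
      intro n h k
      cases k with
      | succ k => exact h k
      | zero =>
        obtain ⟨C, hC⟩ := h 0
        have hc : Continuous (iteratedDeriv n g) :=
          hg.continuous_iteratedDeriv n (mod_cast le_top)
        obtain ⟨B, hB⟩ := (isCompact_Icc (a := (-1 : ℝ)) (b := 1)).exists_bound_of_continuousOn
          hc.continuousOn
        refine ⟨max B C, fun x => ?_⟩
        rw [pow_zero, one_mul]
        rcases le_total |x| 1 with hx | hx
        · exact (hB x (abs_le.1 hx)).trans (le_max_left _ _)
        · refine le_trans ?_ ((hC x).trans (le_max_right _ _))
          rw [zero_add, pow_one]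
          exact le_mul_of_one_le_left (norm_nonneg _) hx
    have hqd : ∀ n k : ℕ, ∃ C : ℝ, ∀ x : ℝ, |x| ^ k * ‖iteratedDeriv n q x‖ ≤ C := fun n k => by
      obtain ⟨C, _, hC⟩ := q.decay k n
      refine ⟨C, fun x => ?_⟩
      simpa [norm_iteratedFDeriv_eq_norm_iteratedDeriv] using hC x
    intro n
    induction n with
    | zero =>
      refine hone _ fun k => ?_
      obtain ⟨C, hC⟩ := hqd 0 k
      refine ⟨C, fun x => le_of_eq_of_le ?_ (hC x)⟩
      rw [iteratedDeriv_zero, iteratedDeriv_zero, hqg, norm_mul, Complex.norm_real, norm_eq_abs]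
      ring
    | succ n ih =>
      refine hone _ fun k => ?_
      obtain ⟨C, hC⟩ := hqd (n + 1) k
      obtain ⟨B, hB⟩ := ih k
      refine ⟨C + (n + 1) * B, fun x => ?_⟩
      -- Leibniz's rule expresses `x g^(n+1)` through `q^(n+1)` and `g^(n)`, the latter controlled
      -- by induction.
      have h1 := congrFun (iteratedDeriv_succ_ofReal_mul hg n) x
      rw [← hfun] at h1
      have h2 : |x| * ‖iteratedDeriv (n + 1) g x‖ ≤
          ‖iteratedDeriv (n + 1) q x‖ + (n + 1) * ‖iteratedDeriv n g x‖ := by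
        calc _ = ‖(x : ℂ) * iteratedDeriv (n + 1) g x‖ := by
              rw [norm_mul, Complex.norm_real, norm_eq_abs]
          _ = ‖iteratedDeriv (n + 1) q x - (n + 1) * iteratedDeriv n g x‖ := by
              rw [h1]; congr 1; ring
          _ ≤ ‖iteratedDeriv (n + 1) q x‖ + ‖((n : ℂ) + 1) * iteratedDeriv n g x‖ :=
              norm_sub_le _ _
          _ = _ := by
              rw [norm_mul]
              congr 2
              exact_mod_cast Complex.norm_natCast (n + 1)
      calc _ = |x| ^ k * (|x| * ‖iteratedDeriv (n + 1) g x‖) := by ring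
        _ ≤ |x| ^ k * (‖iteratedDeriv (n + 1) q x‖ + (n + 1) * ‖iteratedDeriv n g x‖) := by
            gcongr
        _ = |x| ^ k * ‖iteratedDeriv (n + 1) q x‖ +
            (n + 1) * (|x| ^ k * ‖iteratedDeriv n g x‖) := by ring
        _ ≤ _ := by
            gcongr
            exacts [hC x, hB x]
  refine ⟨⟨g, hg, fun k n => ?_⟩, hqg⟩
  obtain ⟨C, hC⟩ := hdecay n k
  refine ⟨C, fun x => ?_⟩
  simpa [norm_iteratedFDeriv_eq_norm_iteratedDeriv] using hC x

theorem even_of_odd_eq_ofReal_mul {q g : ℝ → ℂ} (hq : Function.Odd q)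
    (h : ∀ x : ℝ, q x = x * g x) : Function.Even g := fun x => by
  rcases eq_or_ne x 0 with rfl | hx
  · simp
  · have h1 := hq x
    rw [h, h] at h1
    have hx' : (x : ℂ) ≠ 0 := by exact_mod_cast hx
    push_cast at h1
    have : (x : ℂ) * (g (-x) - g x) = 0 := by linear_combination -h1
    exact sub_eq_zero.1 ((mul_eq_zero.1 this).resolve_left hx')

/-- The derivative of an even Schwartz function is `x` times an even Schwartz function. -/
theorem exists_even_deriv_eq_ofReal_mul (g : 𝓢(ℝ, ℂ)) (hg : Function.Even g) :
    ∃ d : 𝓢(ℝ, ℂ), Function.Even d ∧ ∀ x : ℝ, deriv g x = x * d x := by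
  have hodd : Function.Odd (deriv g) := fun x => by
    have h1 : deriv (fun x => g (-x)) x = -deriv g (-x) := deriv_comp_neg _ _
    have h2 : (fun x => g (-x)) = g := funext hg
    rw [h2] at h1
    rw [h1, neg_neg]
  obtain ⟨d, hd⟩ := exists_schwartzMap_eq_ofReal_mul (SchwartzMap.derivCLM ℂ ℂ g) (by
    have := hodd 0
    rw [neg_zero] at this
    rw [SchwartzMap.derivCLM_apply]
    linear_combination this / 2)
  exact ⟨d, even_of_odd_eq_ofReal_mul hodd hd, hd⟩

/-! ### Hankel transforms on the half line and their decay. -/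

/-- Continuous functions on the open half line that are bounded near `0` and rapidly decreasing at
infinity. -/
def HalfLineRapid (h : ℝ → ℂ) : Prop :=
  ContinuousOn h (Ioi 0) ∧ ∀ k : ℕ, ∃ C, ∀ w, 0 < w → w ^ k * ‖h w‖ ≤ C

theorem HalfLineRapid.pow_mul {h : ℝ → ℂ} (hh : HalfLineRapid h) (j : ℕ) :
    HalfLineRapid fun w => (w : ℂ) ^ j * h w := by
  refine ⟨ContinuousOn.mul (by fun_prop) hh.1, fun k => ?_⟩
  obtain ⟨C, hC⟩ := hh.2 (k + j)
  refine ⟨C, fun w hw => le_of_eq_of_le ?_ (hC w hw)⟩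
  rw [norm_mul, norm_pow, Complex.norm_real, norm_eq_abs, abs_of_pos hw]
  ring

theorem halfLineRapid_comp_rpow (φ : 𝓢(ℝ, ℂ)) {b : ℝ} (hb : 0 < b) :
    HalfLineRapid fun w => φ (w ^ b) := by
  refine ⟨φ.continuous.comp_continuousOn fun w hw =>
    (continuousAt_rpow_const w b (Or.inr hb.le)).continuousWithinAt, fun k => ?_⟩
  obtain ⟨N, hN⟩ := exists_nat_ge (k / b)
  obtain ⟨C, _, hC⟩ := φ.decay N 0
  obtain ⟨B, _, hB⟩ := φ.decay 0 0
  refine ⟨B + C, fun w hw => ?_⟩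
  have hB := hB (w ^ b)
  have hC := hC (w ^ b)
  have hwb : 0 < w ^ b := rpow_pos_of_pos hw b
  simp only [pow_zero, one_mul, norm_iteratedFDeriv_zero, norm_eq_abs, abs_of_pos hwb] at hB hC
  have key : w ^ k ≤ 1 + (w ^ b) ^ N := by
    rcases le_total w 1 with h1 | h1
    · have := pow_le_one₀ hw.le h1 (n := k)
      have : 0 ≤ (w ^ b) ^ N := by positivity
      linarith
    · have : w ^ k ≤ (w ^ b) ^ N := by
        rw [← rpow_natCast, ← rpow_natCast, ← rpow_mul hw.le]
        refine rpow_le_rpow_of_exponent_le h1 ?_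
        rw [div_le_iff₀ hb] at hN
        linarith
      linarith
  calc _ ≤ (1 + (w ^ b) ^ N) * ‖φ (w ^ b)‖ := by gcongr
    _ ≤ _ := by linarith

theorem HalfLineRapid.integrableOn_rpow_mul_norm {h : ℝ → ℂ} (hh : HalfLineRapid h) {α : ℝ}
    (hα : -1 < α) : IntegrableOn (fun w : ℝ => w ^ α * ‖h w‖) (Ioi 0) := by
  obtain ⟨N, hN⟩ := exists_nat_gt (α + 1)
  obtain ⟨B, hB⟩ := hh.2 0
  obtain ⟨C, hC⟩ := hh.2 N
  have := mellin_convergent_of_isBigO_scalar (a := N) (b := 0) (s := α + 1)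
    (f := fun w => ‖h w‖) (hh.1.norm.locallyIntegrableOn measurableSet_Ioi) ?_ hN ?_
    (by linarith)
  · simpa using this
  · refine Asymptotics.IsBigO.of_bound C ?_
    filter_upwards [eventually_gt_atTop 0] with w hw
    rw [norm_norm, norm_eq_abs, rpow_neg hw.le, rpow_natCast, abs_of_pos (by positivity),
      ← div_eq_mul_inv, le_div_iff₀ (by positivity), mul_comm]
    exact hC w hw
  · refine Asymptotics.IsBigO.of_bound B ?_
    filter_upwards [self_mem_nhdsWithin] with w hw
    simpa using hB w hw

theorem HalfLineRapid.integrableOn_mul {h : ℝ → ℂ} (hh : HalfLineRapid h) {α : ℝ} (hα : -1 < α)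
    {m : ℝ → ℝ} (hm : ContinuousOn m (Ioi 0)) {C : ℝ} (hC : ∀ w, 0 < w → |m w| ≤ C * (1 + w)) :
    IntegrableOn (fun w : ℝ => ((m w * w ^ α : ℝ) : ℂ) * h w) (Ioi 0) := by
  have h1 := ((hh.integrableOn_rpow_mul_norm hα).add
    ((hh.pow_mul 1).integrableOn_rpow_mul_norm hα)).const_mul C
  refine Integrable.mono' h1 ?_ ?_
  · refine ContinuousOn.aestronglyMeasurable (ContinuousOn.mul ?_ hh.1) measurableSet_Ioi
    refine Complex.continuous_ofReal.comp_continuousOn (hm.mul fun w hw => ?_)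
    exact (continuousAt_rpow_const w α (Or.inl (ne_of_gt hw))).continuousWithinAt
  · refine (ae_restrict_mem measurableSet_Ioi).mono fun w hw => ?_
    have hw' : 0 < w := hw
    have h2 := rpow_pos_of_pos hw' α
    simp only [Pi.add_apply, norm_mul, Complex.norm_real, norm_eq_abs, abs_of_pos h2, pow_one,
      abs_of_pos hw']
    calc |m w| * w ^ α * ‖h w‖ ≤ C * (1 + w) * w ^ α * ‖h w‖ := by
          gcongr
          exact hC w hw
      _ = _ := by ring

/-- The Hankel transform of order `ν` in the squared variables. -/
noncomputable def hankel (ν : ℝ) (h : ℝ → ℂ) (s : ℝ) : ℂ :=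
  ∫ w in Ioi (0 : ℝ), ((besselClifford ν (w * s) * w ^ ν : ℝ) : ℂ) * h w

theorem exists_abs_besselClifford_mul_le {ν : ℝ} (hν : -1 < ν) : ∃ C, 0 < C ∧ ∀ w s, 0 ≤ w →
    0 ≤ s → |besselClifford ν (w * s)| ≤ C * (1 + w) * (1 + s) := by
  obtain ⟨C, hC0, hC⟩ := exists_abs_besselClifford_le hν
  refine ⟨C, hC0, fun w s hw hs => (hC _ (mul_nonneg hw hs)).trans ?_⟩
  rw [mul_assoc]
  gcongr
  nlinarith

theorem HalfLineRapid.integrableOn_hankel {h : ℝ → ℂ} (hh : HalfLineRapid h) {ν : ℝ}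
    (hν : -1 < ν) {α : ℝ} (hα : -1 < α) {s : ℝ} (hs : 0 ≤ s) :
    IntegrableOn (fun w : ℝ => ((besselClifford ν (w * s) * w ^ α : ℝ) : ℂ) * h w) (Ioi 0) := by
  obtain ⟨C, -, hC⟩ := exists_abs_besselClifford_mul_le hν
  refine hh.integrableOn_mul hα (m := fun w => besselClifford ν (w * s)) (C := C * (1 + s)) ?_
    fun w hw => (hC w s hw.le hs).trans_eq (by ring)
  have := continuous_besselClifford hν
  fun_prop

/-- Integration by parts against `w^(ν+1) E_(ν+1)(ws)`. Only integrability is asked of `d`, since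
`h'` may be a sum of rapid functions. -/
theorem HalfLineRapid.hankel_parts {h d : ℝ → ℂ} (hh : HalfLineRapid h) {ν : ℝ} (hν : -1 < ν)
    (hd : ∀ w, 0 < w → HasDerivAt h (d w) w) {s : ℝ} (hs : 0 ≤ s)
    (hdi : IntegrableOn (fun w : ℝ =>
      ((besselClifford (ν + 1) (w * s) * w ^ (ν + 1) : ℝ) : ℂ) * d w) (Ioi 0)) :
    hankel ν h s = -hankel (ν + 1) d s := by
  have hν1 : -1 < ν + 1 := by linarith
  set v : ℝ → ℂ := fun w => ((w ^ (ν + 1) * besselClifford (ν + 1) (w * s) : ℝ) : ℂ)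
  set v' : ℝ → ℂ := fun w => ((w ^ ν * besselClifford ν (w * s) : ℝ) : ℂ)
  have hv : ∀ w ∈ Ioi (0 : ℝ), HasDerivAt v (v' w) w := fun w hw =>
    (hasDerivAt_rpow_mul_besselClifford hν s hw).ofReal_comp
  have huv : IntegrableOn (h * v) (Ioi 0) := by
    refine (hh.integrableOn_hankel hν1 hν1 hs).congr_fun (fun w _ => ?_) measurableSet_Ioi
    simp only [Pi.mul_apply, v]
    rw [mul_comm (w ^ (ν + 1)), mul_comm]
  have huv' : IntegrableOn (h * v') (Ioi 0) := by
    refine (hh.integrableOn_hankel hν hν hs).congr_fun (fun w _ => ?_) measurableSet_Ioi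
    simp only [Pi.mul_apply, v']
    rw [mul_comm (w ^ ν), mul_comm]
  have hu'v : IntegrableOn (d * v) (Ioi 0) := by
    refine hdi.congr_fun (fun w _ => ?_) measurableSet_Ioi
    simp only [Pi.mul_apply, v]
    rw [mul_comm (w ^ (ν + 1)), mul_comm]
  have hzero : Tendsto (h * v) (𝓝[>] 0) (𝓝 0) := by
    obtain ⟨B, hB⟩ := hh.2 0
    have h1 : Tendsto v (𝓝[>] 0) (𝓝 0) := by
      have hc : ContinuousAt v 0 := by
        have := (continuous_besselClifford hν1)
        refine Complex.continuous_ofReal.continuousAt.comp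
          ((continuousAt_rpow_const 0 (ν + 1) (Or.inr (by linarith))).mul ?_)
        fun_prop
      have h0 : v 0 = 0 := by
        simp [v, zero_rpow (show ν + 1 ≠ 0 by linarith)]
      have := hc.tendsto
      rw [h0] at this
      exact this.mono_left nhdsWithin_le_nhds
    refine squeeze_zero_norm' (a := fun w => B * ‖v w‖) ?_ (by simpa using h1.norm.const_mul B)
    filter_upwards [self_mem_nhdsWithin] with w hw
    rw [Pi.mul_apply, norm_mul]
    gcongr
    simpa using hB w hw
  -- No pointwise bound is needed at infinity: the product and its derivative are both integrable.
  have hinfty : Tendsto (h * v) atTop (𝓝 0) :=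
    tendsto_zero_of_hasDerivAt_of_integrableOn_Ioi (a := 0)
      (fun w hw => (hd w hw).mul (hv w hw)) (hu'v.add huv') huv
  have key := integral_Ioi_mul_deriv_eq_deriv_mul (fun w hw => hd w hw) hv huv' hu'v hzero hinfty
  rw [sub_zero, zero_sub] at key
  unfold hankel
  refine Eq.trans (integral_congr_ae (ae_of_all _ fun w => ?_)) (key.trans (congrArg _
    (integral_congr_ae (ae_of_all _ fun w => ?_))))
  · simp only [v']
    rw [mul_comm (w ^ ν), mul_comm]
  · simp only [v]
    rw [mul_comm (w ^ (ν + 1)), mul_comm]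

/-- At large order `(ws)^k E_ν(ws)` is bounded, so `s^k` is absorbed by the kernel and the
integrable weight `w^(ν-k)` is left. -/
theorem HalfLineRapid.exists_pow_mul_norm_hankel_le {h : ℝ → ℂ} (hh : HalfLineRapid h) (k : ℕ)
    {ν : ℝ} (hν : 2 * (k : ℝ) ≤ ν) : ∃ C, ∀ s, 0 < s → s ^ k * ‖hankel ν h s‖ ≤ C := by
  obtain ⟨C, hC⟩ := exists_pow_mul_abs_besselClifford_le k (ν := ν) (by linarith)
  have hk : (0 : ℝ) ≤ k := k.cast_nonneg
  have hint := (hh.integrableOn_rpow_mul_norm (α := ν - k) (by linarith)).const_mul C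
  refine ⟨∫ w in Ioi (0 : ℝ), C * (w ^ (ν - k) * ‖h w‖), fun s hs => ?_⟩
  have h1 : s ^ k * ‖hankel ν h s‖ = ‖∫ w in Ioi (0 : ℝ), ((s ^ k : ℝ) : ℂ) *
      (((besselClifford ν (w * s) * w ^ ν : ℝ) : ℂ) * h w)‖ := by
    rw [integral_const_mul, norm_mul, Complex.norm_real, norm_eq_abs, abs_of_pos (by positivity)]
    rfl
  rw [h1]
  refine norm_integral_le_of_norm_le hint ((ae_restrict_mem measurableSet_Ioi).mono fun w hw => ?_)
  have hw' : 0 < w := hw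
  have h2 : w ^ ν = w ^ k * w ^ (ν - k) := by
    rw [← rpow_natCast, ← rpow_add hw']
    congr 1
    ring
  have h3 := rpow_pos_of_pos hw' (ν - k)
  rw [h2]
  simp only [norm_mul, Complex.norm_real, norm_eq_abs, abs_of_pos h3, abs_pow, abs_of_pos hw',
    abs_of_pos hs]
  calc _ = (w * s) ^ k * |besselClifford ν (w * s)| * (w ^ (ν - k) * ‖h w‖) := by
        rw [mul_pow]; ring
    _ ≤ _ := by
        gcongr
        exact hC _ (by positivity)

/-- Integrations by parts raise the order until the kernel bound applies. With `g'(x) = x d(x)`, the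
chain rule for `g(w^(m/2))` produces `w^(m/2-1) w^(m/2) = w^(m-1)`, a natural power, so boundedness
near 0 is never lost. -/
theorem exists_pow_mul_norm_hankel_comp_rpow_le {m : ℕ} (hm : 0 < m) (k : ℕ) {ν : ℝ}
    (hν : -1 < ν) (g : 𝓢(ℝ, ℂ)) (hg : Function.Even g) (j : ℕ) :
    ∃ C, ∀ s, 0 < s →
      s ^ k * ‖hankel ν (fun w => (w : ℂ) ^ j * g (w ^ ((m : ℝ) / 2))) s‖ ≤ C := by
  have hm' : (0 : ℝ) < m := by exact_mod_cast hm
  have hm2 : (0 : ℝ) < (m : ℝ) / 2 := by positivity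
  have hrapid : ∀ (g : 𝓢(ℝ, ℂ)) (j : ℕ),
      HalfLineRapid fun w => (w : ℂ) ^ j * g (w ^ ((m : ℝ) / 2)) := fun g j =>
    (halfLineRapid_comp_rpow g hm2).pow_mul j
  -- This `n` bounds the number of integrations by parts needed to reach order `2k`.
  obtain ⟨n, hn⟩ := exists_nat_ge (2 * (k : ℝ) - ν)
  induction n generalizing ν g j with
  | zero =>
    exact (hrapid g j).exists_pow_mul_norm_hankel_le k (by simp at hn; linarith)
  | succ n ih =>
    push_cast at hn
    have hν1 : -1 < ν + 1 := by linarith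
    obtain ⟨d, hde, hd⟩ := exists_even_deriv_eq_ofReal_mul g hg
    -- For `j = 0` the truncated exponent is harmless, since this term carries the coefficient `j`.
    obtain ⟨C₁, h1⟩ := ih hν1 g hg (j - 1) (by linarith)
    obtain ⟨C₂, h2⟩ := ih hν1 d hde (j + (m - 1)) (by linarith)
    refine ⟨j * C₁ + (m : ℝ) / 2 * C₂, fun s hs => ?_⟩
    have i1 := ((hrapid g (j - 1)).integrableOn_hankel hν1 hν1 hs.le).const_mul (j : ℂ)
    have i2 := ((hrapid d (j + (m - 1))).integrableOn_hankel hν1 hν1 hs.le).const_mul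
      (((m : ℝ) / 2 : ℝ) : ℂ)
    have hderiv : ∀ w : ℝ, 0 < w → HasDerivAt (fun w : ℝ => (w : ℂ) ^ j * g (w ^ ((m : ℝ) / 2)))
        (j * ((w : ℂ) ^ (j - 1) * g (w ^ ((m : ℝ) / 2))) + (((m : ℝ) / 2 : ℝ) : ℂ) *
          ((w : ℂ) ^ (j + (m - 1)) * d (w ^ ((m : ℝ) / 2)))) w := fun w hw => by
      have e1 : HasDerivAt (fun w : ℝ => (w : ℂ) ^ j) (j * (w : ℂ) ^ (j - 1)) w := by
        simpa using (hasDerivAt_pow j (w : ℂ)).comp_ofReal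
      have e2 : HasDerivAt (fun w : ℝ => g (w ^ ((m : ℝ) / 2)))
          (((m : ℝ) / 2 * w ^ ((m : ℝ) / 2 - 1)) • deriv g (w ^ ((m : ℝ) / 2))) w :=
        HasDerivAt.scomp (h := fun w : ℝ => w ^ ((m : ℝ) / 2)) w (g.hasDerivAt _)
          (hasDerivAt_rpow_const (Or.inl hw.ne'))
      refine (e1.mul e2).congr_deriv ?_
      have e3 : w ^ ((m : ℝ) / 2 - 1) * w ^ ((m : ℝ) / 2) = w ^ (m - 1) := by
        rw [← rpow_add hw, ← rpow_natCast]
        congr 1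
        rw [Nat.cast_sub hm]
        push_cast
        ring
      have e4 : ((w ^ ((m : ℝ) / 2 - 1) : ℝ) : ℂ) * ((w ^ ((m : ℝ) / 2) : ℝ) : ℂ) =
          (w : ℂ) ^ (m - 1) := by
        exact_mod_cast e3
      rw [hd, Complex.real_smul, Complex.ofReal_mul, pow_add]
      linear_combination (w : ℂ) ^ j * (((m : ℝ) / 2 : ℝ) : ℂ) * d (w ^ ((m : ℝ) / 2)) * e4
    have hsplit : ∀ w : ℝ, ((besselClifford (ν + 1) (w * s) * w ^ (ν + 1) : ℝ) : ℂ) *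
        (j * ((w : ℂ) ^ (j - 1) * g (w ^ ((m : ℝ) / 2))) + (((m : ℝ) / 2 : ℝ) : ℂ) *
          ((w : ℂ) ^ (j + (m - 1)) * d (w ^ ((m : ℝ) / 2)))) =
        j * (((besselClifford (ν + 1) (w * s) * w ^ (ν + 1) : ℝ) : ℂ) *
          ((w : ℂ) ^ (j - 1) * g (w ^ ((m : ℝ) / 2)))) + (((m : ℝ) / 2 : ℝ) : ℂ) *
        (((besselClifford (ν + 1) (w * s) * w ^ (ν + 1) : ℝ) : ℂ) *
          ((w : ℂ) ^ (j + (m - 1)) * d (w ^ ((m : ℝ) / 2)))) := fun w => by ring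
    have hparts := (hrapid g j).hankel_parts hν hderiv hs.le (by
      simp_rw [hsplit]
      exact i1.add i2)
    have hval : hankel (ν + 1) (fun w : ℝ => j * ((w : ℂ) ^ (j - 1) * g (w ^ ((m : ℝ) / 2))) +
        (((m : ℝ) / 2 : ℝ) : ℂ) * ((w : ℂ) ^ (j + (m - 1)) * d (w ^ ((m : ℝ) / 2)))) s =
        j * hankel (ν + 1) (fun w => (w : ℂ) ^ (j - 1) * g (w ^ ((m : ℝ) / 2))) s +
        (((m : ℝ) / 2 : ℝ) : ℂ) *
          hankel (ν + 1) (fun w => (w : ℂ) ^ (j + (m - 1)) * d (w ^ ((m : ℝ) / 2))) s := by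
      unfold hankel
      simp_rw [hsplit]
      rw [integral_add i1 i2, integral_const_mul, integral_const_mul]
    rw [hparts, hval, norm_neg]
    calc _ ≤ s ^ k * (‖(j : ℂ) *
            hankel (ν + 1) (fun w => (w : ℂ) ^ (j - 1) * g (w ^ ((m : ℝ) / 2))) s‖ +
          ‖(((m : ℝ) / 2 : ℝ) : ℂ) *
            hankel (ν + 1) (fun w => (w : ℂ) ^ (j + (m - 1)) * d (w ^ ((m : ℝ) / 2))) s‖) := by
          gcongr
          exact norm_add_le _ _
      _ = j * (s ^ k *
            ‖hankel (ν + 1) (fun w => (w : ℂ) ^ (j - 1) * g (w ^ ((m : ℝ) / 2))) s‖) +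
          (m : ℝ) / 2 * (s ^ k *
            ‖hankel (ν + 1) (fun w => (w : ℂ) ^ (j + (m - 1)) * d (w ^ ((m : ℝ) / 2))) s‖) := by
          rw [norm_mul, norm_mul, Complex.norm_natCast, Complex.norm_real, norm_eq_abs,
            abs_of_pos hm2]
          ring
      _ ≤ _ := by
          gcongr
          exacts [h1 s hs, h2 s hs]

/-! ### Laplace transforms and the obstruction to rapid decay. -/

theorem integrableOn_rpow_mul_exp_neg_mul {ν : ℝ} (hν : -1 < ν) {p : ℝ} (hp : 0 < p) :
    IntegrableOn (fun s : ℝ => s ^ ν * exp (-(p * s))) (Ioi 0) := by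
  simpa using integrableOn_rpow_mul_exp_neg_mul_rpow hν zero_lt_one hp

theorem HalfLineRapid.aestronglyMeasurable_hankel_kernel {h : ℝ → ℂ} (hh : HalfLineRapid h) {ν : ℝ}
    (hν : -1 < ν) :
    AEStronglyMeasurable (fun z : ℝ × ℝ =>
      ((besselClifford ν (z.2 * z.1) * z.2 ^ ν : ℝ) : ℂ) * h z.2)
      ((volume.restrict (Ioi 0)).prod (volume.restrict (Ioi 0))) := by
  rw [Measure.prod_restrict]
  refine ContinuousOn.aestronglyMeasurable ?_ (measurableSet_Ioi.prod measurableSet_Ioi)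
  have h1 := continuous_besselClifford hν
  have h2 : ContinuousOn (fun z : ℝ × ℝ => z.2 ^ ν) (Ioi 0 ×ˢ Ioi 0) :=
    ContinuousOn.rpow_const (by fun_prop) fun z hz => Or.inl (ne_of_gt hz.2)
  have h3 : ContinuousOn (fun z : ℝ × ℝ => h z.2) (Ioi 0 ×ˢ Ioi 0) :=
    hh.1.comp (by fun_prop) fun z hz => hz.2
  have h4 : ContinuousOn (fun z : ℝ × ℝ => besselClifford ν (z.2 * z.1)) (Ioi 0 ×ˢ Ioi 0) := by
    fun_prop
  exact (Complex.continuous_ofReal.comp_continuousOn (h4.mul h2)).mul h3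

theorem HalfLineRapid.aestronglyMeasurable_hankel {h : ℝ → ℂ} (hh : HalfLineRapid h) {ν : ℝ}
    (hν : -1 < ν) : AEStronglyMeasurable (hankel ν h) (volume.restrict (Ioi 0)) :=
  (hh.aestronglyMeasurable_hankel_kernel hν).integral_prod_right'

/-- The Laplace transform of the Hankel transform. -/
theorem HalfLineRapid.integral_hankel_mul_exp {h : ℝ → ℂ} (hh : HalfLineRapid h) {ν : ℝ}
    (hν : -1 < ν) {p : ℝ} (hp : 0 < p) :
    ∫ s in Ioi (0 : ℝ), hankel ν h s * ((s ^ ν * exp (-(p * s)) : ℝ) : ℂ) =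
      ∫ v in Ioi (0 : ℝ), ((v ^ ν * exp (-v) : ℝ) : ℂ) * h (p * v) := by
  set F : ℝ → ℝ → ℂ := fun s w => (((besselClifford ν (w * s) * w ^ ν : ℝ) : ℂ) * h w) *
    ((s ^ ν * exp (-(p * s)) : ℝ) : ℂ)
  -- Fubini applies because the kernel is at most `C(1+w)(1+s)`, a product dominated by the rapid
  -- decay of `h` and by the exponential.
  have hF : Integrable (Function.uncurry F)
      ((volume.restrict (Ioi 0)).prod (volume.restrict (Ioi 0))) := by
    obtain ⟨C, hC0, hC⟩ := exists_abs_besselClifford_mul_le hν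
    have i1 : IntegrableOn (fun w => C * (w ^ ν * ‖h w‖ + w ^ ν * ‖(w : ℂ) ^ 1 * h w‖)) (Ioi 0) :=
      ((hh.integrableOn_rpow_mul_norm hν).add
        ((hh.pow_mul 1).integrableOn_rpow_mul_norm hν)).const_mul C
    have i2 : IntegrableOn (fun s : ℝ => s ^ ν * exp (-(p * s)) + s ^ (ν + 1) * exp (-(p * s)))
        (Ioi 0) := (integrableOn_rpow_mul_exp_neg_mul hν hp).add
      (integrableOn_rpow_mul_exp_neg_mul (by linarith) hp)
    refine Integrable.mono' (i2.mul_prod i1) ?_ ?_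
    · refine (hh.aestronglyMeasurable_hankel_kernel hν).mul ?_
      have : Measurable fun z : ℝ × ℝ => ((z.1 ^ ν * exp (-(p * z.1)) : ℝ) : ℂ) := by fun_prop
      exact this.aestronglyMeasurable
    · rw [Measure.prod_restrict]
      refine (ae_restrict_mem (measurableSet_Ioi.prod measurableSet_Ioi)).mono fun z hz => ?_
      have hs : 0 < z.1 := hz.1
      have hw : 0 < z.2 := hz.2
      have e1 := rpow_pos_of_pos hs ν
      have e2 := rpow_pos_of_pos hw ν
      simp only [Function.uncurry, F, norm_mul, Complex.norm_real, norm_eq_abs, abs_of_pos e1,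
        abs_of_pos e2, abs_exp, pow_one, abs_of_pos hw]
      calc _ ≤ C * (1 + z.2) * (1 + z.1) * z.2 ^ ν * ‖h z.2‖ *
            (z.1 ^ ν * exp (-(p * z.1))) := by
            gcongr
            exact hC _ _ hw.le hs.le
        _ = _ := by
            rw [rpow_add hs, rpow_one]
            ring
  have hswap := integral_integral_swap hF
  have hleft : ∫ s in Ioi (0 : ℝ), hankel ν h s * ((s ^ ν * exp (-(p * s)) : ℝ) : ℂ) =
      ∫ s in Ioi (0 : ℝ), ∫ w in Ioi (0 : ℝ), F s w := by
    refine integral_congr_ae (ae_of_all _ fun s => ?_)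
    simp only [F, hankel]
    rw [integral_mul_const]
  have hright : ∀ w : ℝ, ∫ s in Ioi (0 : ℝ), F s w =
      (((1 / p) ^ (ν + 1) * exp (-(w / p)) * w ^ ν : ℝ) : ℂ) * h w := fun w => by
    have : ∀ s, F s w = ((besselClifford ν (w * s) * (s ^ ν * exp (-(p * s))) : ℝ) : ℂ) *
        (((w ^ ν : ℝ) : ℂ) * h w) := fun s => by
      simp only [F]
      push_cast
      ring
    simp_rw [this]
    rw [integral_mul_const, integral_complex_ofReal, integral_besselClifford_mul_exp hν w hp]
    push_cast
    ring
  rw [hleft, hswap]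
  simp_rw [hright]
  have hsub := integral_comp_mul_left_Ioi (fun w : ℝ =>
    (((1 / p) ^ (ν + 1) * exp (-(w / p)) * w ^ ν : ℝ) : ℂ) * h w) 0 hp
  rw [mul_zero] at hsub
  have : ∫ w in Ioi (0 : ℝ), (((1 / p) ^ (ν + 1) * exp (-(w / p)) * w ^ ν : ℝ) : ℂ) * h w =
      (p : ℂ) * ∫ v in Ioi (0 : ℝ),
        (((1 / p) ^ (ν + 1) * exp (-(p * v / p)) * (p * v) ^ ν : ℝ) : ℂ) * h (p * v) := by
    rw [hsub, Complex.real_smul, ← mul_assoc, ← Complex.ofReal_mul, mul_inv_cancel₀ hp.ne',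
      Complex.ofReal_one, one_mul]
  rw [this, ← integral_const_mul]
  refine setIntegral_congr_fun measurableSet_Ioi fun v hv => ?_
  have hv' : 0 < v := hv
  have e1 : p * ((1 / p) ^ (ν + 1) * exp (-(p * v / p)) * (p * v) ^ ν) = v ^ ν * exp (-v) := by
    have e2 := (rpow_pos_of_pos hp ν).ne'
    rw [mul_div_cancel_left₀ _ hp.ne', mul_rpow hp.le hv'.le, one_div, inv_rpow hp.le,
      rpow_add hp, rpow_one]
    field_simp
  rw [← mul_assoc, ← Complex.ofReal_mul, e1]

/-- The derivative of each remainder is minus the previous one, so the mean value inequality gives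
one more factor `x`; the factorial is not needed. -/
theorem abs_exp_neg_sub_sum_le (N : ℕ) {x : ℝ} (hx : 0 ≤ x) :
    |exp (-x) - ∑ n ∈ Finset.range N, (-x) ^ n / n.factorial| ≤ x ^ N := by
  induction N generalizing x with
  | zero => simpa [abs_exp] using hx
  | succ N ih =>
    have hd : ∀ y : ℝ, HasDerivAt
        (fun y => exp (-y) - ∑ n ∈ Finset.range (N + 1), (-y) ^ n / n.factorial)
        (-(exp (-y) - ∑ n ∈ Finset.range N, (-y) ^ n / n.factorial)) y := fun y => by
      have h1 : HasDerivAt (fun y : ℝ => exp (-y)) (-exp (-y)) y := by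
        simpa using (hasDerivAt_neg y).exp
      have h2 : HasDerivAt (fun y : ℝ => ∑ n ∈ Finset.range (N + 1), (-y) ^ n / n.factorial)
          (∑ n ∈ Finset.range (N + 1), (n * (-y) ^ (n - 1) * (-1)) / n.factorial) y :=
        HasDerivAt.fun_sum fun n _ => ((hasDerivAt_neg y).fun_pow n).div_const _
      refine (h1.sub h2).congr_deriv ?_
      rw [Finset.sum_range_succ']
      have : ∀ n : ℕ, (((n + 1 : ℕ) : ℝ) * (-y) ^ (n + 1 - 1) * (-1)) / (n + 1).factorial =
          -((-y) ^ n / n.factorial) := fun n => by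
        have h3 : ((n : ℝ) + 1) ≠ 0 := by positivity
        have h4 : (n.factorial : ℝ) ≠ 0 := by positivity
        rw [Nat.factorial_succ, Nat.add_sub_cancel]
        push_cast
        field_simp
      simp_rw [this]
      simp
      ring
    have := (convex_Icc (0 : ℝ) x).norm_image_sub_le_of_norm_hasDerivWithin_le (C := x ^ N)
      (fun y _ => (hd y).hasDerivWithinAt) (fun y hy => by
        rw [norm_neg]
        exact (ih hy.1).trans (pow_le_pow_left₀ hy.1 hy.2 N))
      (left_mem_Icc.2 hx) (right_mem_Icc.2 hx)
    have h0 : ∑ n ∈ Finset.range (N + 1), (-(0 : ℝ)) ^ n / n.factorial = 1 := by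
      rw [Finset.sum_range_succ']
      simp
    rw [h0] at this
    simpa [abs_of_nonneg hx, pow_succ] using this

/-- The Laplace transform of a function with all moments has a Taylor polynomial at `0⁺`. -/
theorem exists_polynomial_laplace {Φ : ℝ → ℂ}
    (hΦ : ∀ n : ℕ, IntegrableOn (fun s : ℝ => (s : ℂ) ^ n * Φ s) (Ioi 0)) (N : ℕ) :
    ∃ (Q : Polynomial ℂ) (K : ℝ), ∀ p : ℝ, 0 < p →
      ‖(∫ s in Ioi (0 : ℝ), Φ s * ((exp (-(p * s)) : ℝ) : ℂ)) - Q.eval (p : ℂ)‖ ≤ K * p ^ N := by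
  refine ⟨∑ n ∈ Finset.range N, Polynomial.C ((-1) ^ n / n.factorial *
    ∫ s in Ioi (0 : ℝ), (s : ℂ) ^ n * Φ s) * Polynomial.X ^ n,
    ∫ s in Ioi (0 : ℝ), ‖(s : ℂ) ^ N * Φ s‖, fun p hp => ?_⟩
  have hsum : (∑ n ∈ Finset.range N, Polynomial.C ((-1) ^ n / n.factorial *
      ∫ s in Ioi (0 : ℝ), (s : ℂ) ^ n * Φ s) * Polynomial.X ^ n).eval (p : ℂ) =
      ∫ s in Ioi (0 : ℝ), ∑ n ∈ Finset.range N,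
        ((-1) ^ n / n.factorial * (p : ℂ) ^ n) * ((s : ℂ) ^ n * Φ s) := by
    rw [integral_finsetSum _ fun n _ => (hΦ n).const_mul _, Polynomial.eval_finsetSum]
    refine Finset.sum_congr rfl fun n _ => ?_
    rw [integral_const_mul]
    simp
    ring
  have hexp : IntegrableOn (fun s : ℝ => Φ s * ((exp (-(p * s)) : ℝ) : ℂ)) (Ioi 0) := by
    have h0 : IntegrableOn Φ (Ioi 0) := by simpa using hΦ 0
    refine Integrable.mono h0 (h0.aestronglyMeasurable.mul ?_) ?_
    · have : Continuous fun s : ℝ => ((exp (-(p * s)) : ℝ) : ℂ) := by fun_prop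
      exact this.aestronglyMeasurable
    · refine (ae_restrict_mem measurableSet_Ioi).mono fun s hs => ?_
      have hs' : 0 < s := hs
      rw [norm_mul, Complex.norm_real, norm_eq_abs, abs_exp]
      refine mul_le_of_le_one_right (norm_nonneg _) (exp_le_one_iff.2 ?_)
      have := mul_pos hp hs'
      linarith
  rw [hsum, ← integral_sub hexp (integrable_finsetSum _ fun n _ => (hΦ n).const_mul _),
    ← integral_mul_const]
  refine norm_integral_le_of_norm_le ((hΦ N).norm.mul_const _)
    ((ae_restrict_mem measurableSet_Ioi).mono fun s hs => ?_)
  have hs' : 0 < s := hs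
  have h1 : Φ s * ((exp (-(p * s)) : ℝ) : ℂ) - ∑ n ∈ Finset.range N,
      ((-1) ^ n / n.factorial * (p : ℂ) ^ n) * ((s : ℂ) ^ n * Φ s) =
      ((exp (-(p * s)) - ∑ n ∈ Finset.range N, (-(p * s)) ^ n / n.factorial : ℝ) : ℂ) * Φ s := by
    push_cast
    rw [sub_mul, Finset.sum_mul, mul_comm (Φ s)]
    congr 1
    refine Finset.sum_congr rfl fun n _ => ?_
    rw [neg_pow ((p : ℂ) * s), mul_pow]
    ring
  rw [h1, norm_mul, Complex.norm_real, norm_eq_abs, norm_mul, norm_pow, Complex.norm_real,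
    norm_eq_abs, abs_of_pos hs']
  calc _ ≤ (p * s) ^ N * ‖Φ s‖ := by
        gcongr
        exact abs_exp_neg_sub_sum_le N (by positivity)
    _ = _ := by rw [mul_pow]; ring

/-- The Laplace transform of `s^ν H_ν h(s)` is computed in two ways as `p → 0+`. The behaviour of
`h` at 0 yields a nonzero multiple of `p^β`; rapid decay of `H_ν h` yields a polynomial up to a
higher-order error. -/
theorem HalfLineRapid.exists_eq_natCast_of_hankel_decay {h : ℝ → ℂ} (hh : HalfLineRapid h) {ν β : ℝ}
    (hν : -1 < ν) (hβ : 0 < β) {c : ℂ} (hc : c ≠ 0)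
    (hlim : Tendsto (fun w : ℝ => h w / ((w ^ β : ℝ) : ℂ)) (𝓝[>] 0) (𝓝 c)) {B : ℝ}
    (hB : ∀ w, 0 < w → ‖h w‖ ≤ B * w ^ β)
    (hdecay : ∀ k : ℕ, ∃ C, ∀ s, 0 < s → s ^ k * ‖hankel ν h s‖ ≤ C) : ∃ n : ℕ, β = n := by
  have hG : 0 < Gamma (ν + β + 1) := Gamma_pos_of_pos (by linarith)
  have hL : Tendsto (fun p : ℝ => (∫ v in Ioi (0 : ℝ), ((v ^ ν * exp (-v) : ℝ) : ℂ) * h (p * v)) /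
      ((p ^ β : ℝ) : ℂ)) (𝓝[>] 0) (𝓝 (((Gamma (ν + β + 1) : ℝ) : ℂ) * c)) := by
    have e1 : ((Gamma (ν + β + 1) : ℝ) : ℂ) * c =
        ∫ v in Ioi (0 : ℝ), ((v ^ (ν + β) * exp (-v) : ℝ) : ℂ) * c := by
      rw [integral_mul_const, integral_complex_ofReal]
      congr 2
      rw [Gamma_eq_integral (by linarith)]
      refine integral_congr_ae (ae_of_all _ fun v => ?_)
      simp [mul_comm]
    rw [e1]
    have e2 : ∀ᶠ p : ℝ in 𝓝[>] 0, ∫ v in Ioi (0 : ℝ), ((v ^ (ν + β) * exp (-v) : ℝ) : ℂ) *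
        (h (p * v) / (((p * v) ^ β : ℝ) : ℂ)) =
        (∫ v in Ioi (0 : ℝ), ((v ^ ν * exp (-v) : ℝ) : ℂ) * h (p * v)) / ((p ^ β : ℝ) : ℂ) := by
      filter_upwards [self_mem_nhdsWithin] with p hp
      have hp' : 0 < p := hp
      rw [← integral_div]
      refine setIntegral_congr_fun measurableSet_Ioi fun v hv => ?_
      have hv' : 0 < v := hv
      have e3 : ((v ^ β : ℝ) : ℂ) ≠ 0 := by exact_mod_cast (rpow_pos_of_pos hv' β).ne'
      have e4 : ((p ^ β : ℝ) : ℂ) ≠ 0 := by exact_mod_cast (rpow_pos_of_pos hp' β).ne'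
      simp only [rpow_add hv', mul_rpow hp'.le hv'.le, Complex.ofReal_mul]
      field_simp
    refine Tendsto.congr' e2 ?_
    refine tendsto_integral_filter_of_dominated_convergence
      (fun v => B * (v ^ (ν + β) * exp (-v))) ?_ ?_ ?_ ?_
    · filter_upwards [self_mem_nhdsWithin] with p hp
      have hp' : 0 < p := hp
      refine AEStronglyMeasurable.mul (Measurable.aestronglyMeasurable (by fun_prop)) ?_
      refine AEStronglyMeasurable.div₀ ?_ (Measurable.aestronglyMeasurable (by fun_prop))
      refine ContinuousOn.aestronglyMeasurable (hh.1.comp (by fun_prop) fun v hv => ?_)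
        measurableSet_Ioi
      exact mul_pos hp' hv
    · filter_upwards [self_mem_nhdsWithin] with p hp
      have hp' : 0 < p := hp
      refine (ae_restrict_mem measurableSet_Ioi).mono fun v hv => ?_
      have hv' : 0 < v := hv
      have e3 := rpow_pos_of_pos hv' (ν + β)
      have e4 := rpow_pos_of_pos (mul_pos hp' hv') β
      rw [norm_mul, norm_div, Complex.norm_real, Complex.norm_real, norm_eq_abs, norm_eq_abs,
        abs_of_pos e4, abs_mul, abs_of_pos e3, abs_exp, mul_comm B]
      gcongr
      rw [div_le_iff₀ e4]
      exact hB _ (mul_pos hp' hv')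
    · have := integrableOn_rpow_mul_exp_neg_mul (show -1 < ν + β by linarith) one_pos
      simp only [one_mul] at this
      exact this.const_mul B
    · refine (ae_restrict_mem measurableSet_Ioi).mono fun v hv => ?_
      refine Tendsto.const_mul _ (hlim.comp ?_)
      refine tendsto_nhdsWithin_iff.2 ⟨?_, ?_⟩
      · refine tendsto_nhdsWithin_of_tendsto_nhds ?_
        have : Continuous fun p : ℝ => p * v := by fun_prop
        simpa using this.tendsto 0
      · filter_upwards [self_mem_nhdsWithin] with p hp
        exact mul_pos (mem_Ioi.1 hp) (mem_Ioi.1 hv)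
  have hrapid : ∀ n : ℕ, IntegrableOn
      (fun s : ℝ => (s : ℂ) ^ n * (hankel ν h s * ((s ^ ν : ℝ) : ℂ))) (Ioi 0) := fun n => by
    -- This makes `s^(ν+n) / (1 + s^N)` integrable at infinity.
    obtain ⟨N, hN⟩ := exists_nat_gt (ν + 1 + n)
    obtain ⟨C₀, h0⟩ := hdecay 0
    obtain ⟨C₁, h1⟩ := hdecay N
    have i1 : IntegrableOn (fun s : ℝ => (s ^ (ν + n)) * (1 + s ^ N)⁻¹) (Ioi 0) := by
      have hc : ContinuousOn (fun s : ℝ => (1 + s ^ N)⁻¹) (Ioi 0) := by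
        refine ContinuousOn.inv₀ (by fun_prop) fun s hs => ?_
        have : (0 : ℝ) < s := hs
        positivity
      have := mellin_convergent_of_isBigO_scalar (a := N) (b := 0) (s := ν + n + 1)
        (f := fun s : ℝ => (1 + s ^ N)⁻¹) (hc.locallyIntegrableOn measurableSet_Ioi) ?_
        (by linarith) ?_ (by have : (0 : ℝ) ≤ n := n.cast_nonneg; linarith)
      · simpa using this
      · refine Asymptotics.IsBigO.of_bound 1 ?_
        filter_upwards [eventually_gt_atTop 0] with s hs
        have : 0 < s ^ N := by positivity
        rw [rpow_neg hs.le, rpow_natCast, norm_inv, norm_inv, one_mul, norm_eq_abs, norm_eq_abs,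
          abs_of_pos this, abs_of_pos (by positivity)]
        gcongr
        linarith
      · refine Asymptotics.IsBigO.of_bound 1 ?_
        filter_upwards [self_mem_nhdsWithin] with s hs
        have hs' : (0 : ℝ) < s := hs
        have : 0 < s ^ N := by positivity
        rw [neg_zero, rpow_zero, norm_inv, norm_eq_abs, abs_of_pos (by positivity)]
        simp only [norm_one, mul_one]
        exact inv_le_one_of_one_le₀ (by linarith)
    refine Integrable.mono' (i1.const_mul (C₀ + C₁)) ?_ ?_
    · exact (Measurable.aestronglyMeasurable (by fun_prop)).mul
        ((hh.aestronglyMeasurable_hankel hν).mul (Measurable.aestronglyMeasurable (by fun_prop)))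
    · refine (ae_restrict_mem measurableSet_Ioi).mono fun s hs => ?_
      have hs' : (0 : ℝ) < s := hs
      have h2 := h0 s hs'
      have h3 := h1 s hs'
      have h4 := rpow_pos_of_pos hs' ν
      have h5 : 0 < 1 + s ^ N := by positivity
      have h6 : ‖hankel ν h s‖ ≤ (C₀ + C₁) * (1 + s ^ N)⁻¹ := by
        rw [← div_eq_mul_inv, le_div_iff₀ h5]
        linarith
      rw [norm_mul, norm_mul, norm_pow, Complex.norm_real, Complex.norm_real, norm_eq_abs,
        norm_eq_abs, abs_of_pos hs', abs_of_pos h4, rpow_add hs', rpow_natCast]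
      calc _ = s ^ n * s ^ ν * ‖hankel ν h s‖ := by ring
        _ ≤ s ^ n * s ^ ν * ((C₀ + C₁) * (1 + s ^ N)⁻¹) := by gcongr
        _ = _ := by ring
  -- With `N > β` the Taylor remainder `O(p^N)` disappears after division by `p^β`.
  obtain ⟨N, hN⟩ := exists_nat_gt β
  obtain ⟨Q, K, hQ⟩ := exists_polynomial_laplace hrapid N
  have hdiff : Tendsto (fun p : ℝ => ((∫ v in Ioi (0 : ℝ), ((v ^ ν * exp (-v) : ℝ) : ℂ) *
      h (p * v)) - Q.eval (p : ℂ)) / ((p ^ β : ℝ) : ℂ)) (𝓝[>] 0) (𝓝 0) := by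
    refine squeeze_zero_norm' (a := fun p : ℝ => K * p ^ ((N : ℝ) - β)) ?_ ?_
    · filter_upwards [self_mem_nhdsWithin] with p hp
      have hp' : 0 < p := hp
      have h1 := hQ p hp'
      have h2 : ∫ s in Ioi (0 : ℝ), hankel ν h s * ((s ^ ν : ℝ) : ℂ) * ((exp (-(p * s)) : ℝ) : ℂ) =
          ∫ v in Ioi (0 : ℝ), ((v ^ ν * exp (-v) : ℝ) : ℂ) * h (p * v) := by
        rw [← hh.integral_hankel_mul_exp hν hp']
        refine integral_congr_ae (ae_of_all _ fun s => ?_)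
        push_cast
        ring
      rw [h2] at h1
      have h3 := rpow_pos_of_pos hp' β
      rw [norm_div, Complex.norm_real, norm_eq_abs, abs_of_pos h3, div_le_iff₀ h3, mul_assoc,
        ← rpow_add hp', sub_add_cancel, rpow_natCast]
      exact h1
    · have h2 : (0 : ℝ) < N - β := by linarith
      have := ((continuous_rpow_const h2.le).tendsto 0).const_mul K
      rw [zero_rpow h2.ne', mul_zero] at this
      exact tendsto_nhdsWithin_of_tendsto_nhds this
  obtain ⟨n, hn, -⟩ := exists_eq_natCast_of_tendsto_polynomial Q (c₀ := 0)
    (mul_ne_zero (Complex.ofReal_ne_zero.2 hG.ne') hc) hβ (by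
      refine ((hL.sub hdiff).congr fun p => ?_).trans_eq ?_
      · ring
      · rw [sub_zero])
  exact ⟨n, hn⟩

/-! ### Regularity of the Hankel transform. -/

theorem HalfLineRapid.exists_norm_hankel_le {h : ℝ → ℂ} (hh : HalfLineRapid h) {ν : ℝ}
    (hν : -1 < ν) : ∃ C, ∀ s, 0 ≤ s → ‖hankel ν h s‖ ≤ C * (1 + s) := by
  obtain ⟨C, hC0, hC⟩ := exists_abs_besselClifford_mul_le hν
  have i1 : IntegrableOn (fun w => C * (w ^ ν * ‖h w‖ + w ^ ν * ‖(w : ℂ) ^ 1 * h w‖)) (Ioi 0) :=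
    ((hh.integrableOn_rpow_mul_norm hν).add
      ((hh.pow_mul 1).integrableOn_rpow_mul_norm hν)).const_mul C
  refine ⟨∫ w in Ioi (0 : ℝ), C * (w ^ ν * ‖h w‖ + w ^ ν * ‖(w : ℂ) ^ 1 * h w‖), fun s hs => ?_⟩
  rw [← integral_mul_const]
  refine norm_integral_le_of_norm_le (i1.mul_const _)
    ((ae_restrict_mem measurableSet_Ioi).mono fun w hw => ?_)
  have hw' : 0 < w := hw
  have e2 := rpow_pos_of_pos hw' ν
  simp only [norm_mul, Complex.norm_real, norm_eq_abs, abs_of_pos e2, pow_one, abs_of_pos hw']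
  calc _ ≤ C * (1 + w) * (1 + s) * w ^ ν * ‖h w‖ := by
        gcongr
        exact hC _ _ hw'.le hs
    _ = _ := by ring

/-- The kernel is controlled only for nonnegative arguments, so a two-sided derivative is taken
after composing with a nonnegative `t`, zeros of `t` included. The factor `w` brought out by the
chain rule turns `w^ν` into `w^(ν+1)`. -/
theorem HalfLineRapid.hasDerivAt_hankel_comp {h : ℝ → ℂ} (hh : HalfLineRapid h) {ν : ℝ}
    (hν : -1 < ν) {t : ℝ → ℝ} (ht : ContDiff ℝ ∞ t) (ht0 : ∀ y, 0 ≤ t y) (y : ℝ) :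
    HasDerivAt (fun y => hankel ν h (t y))
      (-((deriv t y : ℝ) : ℂ) * hankel (ν + 1) h (t y)) y := by
  have hν1 : -1 < ν + 1 := by linarith
  have htd : ∀ y, HasDerivAt t (deriv t y) y := fun y =>
    (ht.differentiable (by simp) y).hasDerivAt
  have htc : Continuous (deriv t) := ht.continuous_deriv (by simp)
  obtain ⟨T, hT⟩ := (isCompact_closedBall y 1).exists_bound_of_continuousOn htc.continuousOn
  set F' : ℝ → ℝ → ℂ := fun y w => -((deriv t y : ℝ) : ℂ) *
    (((besselClifford (ν + 1) (w * t y) * w ^ (ν + 1) : ℝ) : ℂ) * h w)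
  have key := (hasDerivAt_integral_of_dominated_loc_of_deriv_le
    (μ := volume.restrict (Ioi 0)) (x₀ := y) (s := Metric.closedBall y 1)
    (F := fun y w => ((besselClifford ν (w * t y) * w ^ ν : ℝ) : ℂ) * h w) (F' := F')
    (bound := fun w => T * besselClifford (ν + 1) 0 * (w ^ (ν + 1) * ‖h w‖))
    (Metric.closedBall_mem_nhds y one_pos)
    (Eventually.of_forall fun y => (hh.integrableOn_hankel hν hν (ht0 y)).aestronglyMeasurable)
    (hh.integrableOn_hankel hν hν (ht0 y))
    ((hh.integrableOn_hankel hν1 hν1 (ht0 y)).const_mul _).aestronglyMeasurable ?_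
    ((hh.integrableOn_rpow_mul_norm hν1).const_mul _) ?_).2
  · rw [integral_const_mul] at key
    exact key
  · refine (ae_restrict_mem measurableSet_Ioi).mono fun w hw z hz => ?_
    have hw' : 0 < w := hw
    have e1 := rpow_pos_of_pos hw' (ν + 1)
    have e2 := hT z hz
    have e3 := abs_besselClifford_le (show -(1 / 2) ≤ ν + 1 by linarith)
      (mul_nonneg hw'.le (ht0 z))
    simp only [F', norm_mul, norm_neg, Complex.norm_real, norm_eq_abs, abs_of_pos e1] at e2 ⊢
    have e4 : 0 ≤ T := (abs_nonneg _).trans e2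
    calc _ ≤ T * (besselClifford (ν + 1) 0 * w ^ (ν + 1) * ‖h w‖) := by gcongr
      _ = _ := by ring
  · refine (ae_restrict_mem measurableSet_Ioi).mono fun w hw z _ => ?_
    have hw' : 0 < w := hw
    have e1 : HasDerivAt (fun y => besselClifford ν (w * t y))
        (-besselClifford (ν + 1) (w * t z) * (w * deriv t z)) z :=
      HasDerivAt.comp (h := fun y => w * t y) z (hasDerivAt_besselClifford hν _)
        ((htd z).const_mul w)
    refine (((e1.mul_const (w ^ ν)).ofReal_comp).mul_const (h w)).congr_deriv ?_
    simp only [F']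
    rw [rpow_add hw', rpow_one]
    push_cast
    ring

theorem HalfLineRapid.contDiff_hankel_comp {h : ℝ → ℂ} (hh : HalfLineRapid h) {ν : ℝ}
    (hν : -1 < ν) {t : ℝ → ℝ} (ht : ContDiff ℝ ∞ t) (ht0 : ∀ y, 0 ≤ t y) :
    ContDiff ℝ ∞ fun y => hankel ν h (t y) := by
  refine contDiff_infty.2 fun n => ?_
  induction n generalizing ν with
  | zero =>
    exact contDiff_zero.2 (continuous_iff_continuousAt.2 fun y =>
      (hh.hasDerivAt_hankel_comp hν ht ht0 y).continuousAt)
  | succ n ih =>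
    push_cast
    rw [contDiff_succ_iff_deriv]
    refine ⟨fun y => (hh.hasDerivAt_hankel_comp hν ht ht0 y).differentiableAt, by simp, ?_⟩
    rw [funext fun y => (hh.hasDerivAt_hankel_comp hν ht ht0 y).deriv]
    have h1 : ContDiff ℝ n (deriv t) := by
      have : ContDiff ℝ ∞ (deriv t) := (contDiff_infty_iff_deriv.1 ht).2
      exact this.of_le (mod_cast le_top)
    exact (Complex.ofRealCLM.contDiff.comp h1).neg.mul (ih (by linarith))

/-- Dominated convergence, with the mean value bound `abs_besselClifford_sub_le` as majorant. The
limit is the coefficient of `y^a`, up to constants, in the necessity of (i). -/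
theorem HalfLineRapid.tendsto_hankel_slope {h : ℝ → ℂ} (hh : HalfLineRapid h) {ν : ℝ}
    (hν : -1 < ν) :
    Tendsto (fun s : ℝ => (hankel ν h s - hankel ν h 0) / (s : ℂ)) (𝓝[>] 0)
      (𝓝 (-((besselClifford (ν + 1) 0 : ℝ) : ℂ) *
        ∫ w in Ioi (0 : ℝ), ((w ^ (ν + 1) : ℝ) : ℂ) * h w)) := by
  have hν1 : -1 < ν + 1 := by linarith
  rw [← integral_const_mul]
  have e1 : ∀ᶠ s : ℝ in 𝓝[>] 0, ∫ w in Ioi (0 : ℝ), (((besselClifford ν (w * s) -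
      besselClifford ν 0) / s * w ^ ν : ℝ) : ℂ) * h w =
      (hankel ν h s - hankel ν h 0) / (s : ℂ) := by
    filter_upwards [self_mem_nhdsWithin] with s hs
    have hs' : 0 < s := hs
    unfold hankel
    rw [← integral_sub (hh.integrableOn_hankel hν hν hs'.le) (hh.integrableOn_hankel hν hν le_rfl),
      ← integral_div]
    refine integral_congr_ae (ae_of_all _ fun w => ?_)
    simp only [mul_zero]
    push_cast
    ring
  refine Tendsto.congr' e1 (tendsto_integral_filter_of_dominated_convergence
    (fun w => besselClifford (ν + 1) 0 * (w ^ (ν + 1) * ‖h w‖)) ?_ ?_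
    ((hh.integrableOn_rpow_mul_norm hν1).const_mul _) ?_)
  · have hc := continuous_besselClifford hν
    refine Eventually.of_forall fun s => ?_
    exact AEStronglyMeasurable.mul (Measurable.aestronglyMeasurable (by fun_prop))
      (hh.1.aestronglyMeasurable measurableSet_Ioi)
  · filter_upwards [self_mem_nhdsWithin] with s hs
    have hs' : 0 < s := hs
    refine (ae_restrict_mem measurableSet_Ioi).mono fun w hw => ?_
    have hw' : 0 < w := hw
    have e2 := abs_besselClifford_sub_le hν (mul_nonneg hw'.le hs'.le)
    have e3 := rpow_pos_of_pos hw' ν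
    rw [norm_mul, Complex.norm_real, norm_eq_abs, abs_mul, abs_div, abs_of_pos hs', abs_of_pos e3,
      rpow_add hw', rpow_one]
    calc _ ≤ besselClifford (ν + 1) 0 * (w * s) / s * w ^ ν * ‖h w‖ := by gcongr
      _ = _ := by field_simp
  · refine (ae_restrict_mem measurableSet_Ioi).mono fun w hw => ?_
    have hw' : 0 < w := hw
    have e2 : HasDerivAt (fun s => besselClifford ν (w * s)) (-besselClifford (ν + 1) 0 * w) 0 := by
      have := HasDerivAt.comp (h := fun s : ℝ => w * s) (h₂ := besselClifford ν) 0
        (hasDerivAt_besselClifford hν _) (hasDerivAt_const_mul w)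
      rwa [mul_zero] at this
    have e3 := (hasDerivAt_iff_tendsto_slope.1 e2).mono_left
      (nhdsWithin_mono 0 (fun x (hx : 0 < x) => ne_of_gt hx : Ioi (0 : ℝ) ⊆ {0}ᶜ))
    have e4 := (Complex.continuous_ofReal.tendsto _).comp (e3.mul_const (w ^ ν))
    have e5 := e4.mul_const (h w)
    refine (e5.congr fun s => ?_).trans_eq ?_
    · simp only [Function.comp, slope_def_field, mul_zero, sub_zero]
    · rw [rpow_add hw', rpow_one]
      congr 1
      push_cast
      ring

/-! ### Reduction of the generalized Fourier transform to Hankel transforms. -/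

theorem mul_index {κ a : ℝ} (ha : 0 < a) : a * index κ a = 2 * κ - 1 := by
  unfold index
  field_simp

theorem neg_one_lt_index {κ a : ℝ} (ha : 0 < a) (hκa : 0 < 2 * (κ - 1 / 2) + a) :
    -1 < index κ a := by
  have := mul_index (κ := κ) ha
  by_contra h
  nlinarith [not_lt.1 h]

theorem exists_kernel_eq (κ : ℝ) {a : ℝ} (ha : 0 < a) : ∃ c : ℂ, ∀ x y : ℝ, kernel κ a x y =
    ((Gamma (index κ a + 1) * besselClifford (index κ a) (|x| ^ a * (|y| ^ a / a ^ 2)) : ℝ) : ℂ) +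
      c * (x * y) *
        ((besselClifford (index κ a + 2 / a) (|x| ^ a * (|y| ^ a / a ^ 2)) : ℝ) : ℂ) := by
  refine ⟨(Gamma (index κ a + 1) / Gamma (index κ a + 1 + 2 / a) : ℝ) *
    ((Gamma (index κ a + 2 / a + 1) : ℝ) : ℂ) / ((a : ℂ) * Complex.I) ^ ((2 / a : ℝ) : ℂ),
    fun x y => ?_⟩
  have h : (2 / a * |x * y| ^ (a / 2) / 2) ^ 2 = |x| ^ a * (|y| ^ a / a ^ 2) := by
    have h1 : (|x * y| ^ (a / 2)) ^ 2 = |x| ^ a * |y| ^ a := by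
      rw [← rpow_natCast, ← rpow_mul (abs_nonneg _), abs_mul,
        ← mul_rpow (abs_nonneg _) (abs_nonneg _)]
      congr 1
      push_cast
      ring
    rw [div_pow, mul_pow, h1]
    field_simp
  rw [kernel, normBessel_eq_besselClifford, normBessel_eq_besselClifford, h]
  push_cast
  ring

theorem integral_besselClifford_comp_rpow {a : ℝ} (ha : 0 < a) (ν α s : ℝ) (φ : ℝ → ℂ) :
    ∫ x in Ioi (0 : ℝ), ((besselClifford ν (x ^ a * s) * x ^ (a * α + a - 1) : ℝ) : ℂ) * φ x =
      (a : ℂ)⁻¹ * ∫ w in Ioi (0 : ℝ),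
        ((besselClifford ν (w * s) * w ^ α : ℝ) : ℂ) * φ (w ^ a⁻¹) := by
  rw [← integral_comp_rpow_Ioi_of_pos (g := fun w =>
    ((besselClifford ν (w * s) * w ^ α : ℝ) : ℂ) * φ (w ^ a⁻¹)) ha, ← integral_const_mul]
  refine setIntegral_congr_fun measurableSet_Ioi fun x hx => ?_
  have hx' : 0 < x := hx
  have h1 : (x ^ a) ^ a⁻¹ = x := by
    rw [← rpow_mul hx'.le, mul_inv_cancel₀ ha.ne', rpow_one]
  have h2 : (x ^ a) ^ α = x ^ (a * α) := (rpow_mul hx'.le _ _).symm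
  have h3 : x ^ (a * α + a - 1) = x ^ (a * α) * x ^ (a - 1) := by
    rw [← rpow_add hx']
    congr 1
    ring
  have h4 : (a : ℂ) ≠ 0 := Complex.ofReal_ne_zero.2 ha.ne'
  simp only [h1, h2, h3, Complex.real_smul]
  push_cast
  field_simp

theorem integrableOn_besselClifford_comp_rpow {a : ℝ} (ha : 0 < a) {ν α : ℝ} (hν : -1 < ν)
    (hα : -1 < α) {s : ℝ} (hs : 0 ≤ s) (φ : 𝓢(ℝ, ℂ)) :
    IntegrableOn (fun x : ℝ =>
      ((besselClifford ν (x ^ a * s) * x ^ (a * α + a - 1) : ℝ) : ℂ) * φ x) (Ioi 0) := by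
  have h := (halfLineRapid_comp_rpow φ (inv_pos.2 ha)).integrableOn_hankel hν hα hs
  rw [← integrableOn_Ioi_comp_rpow_iff' _ ha.ne'] at h
  refine h.congr_fun (fun x hx => ?_) measurableSet_Ioi
  have hx' : 0 < x := hx
  have h1 : (x ^ a) ^ a⁻¹ = x := by
    rw [← rpow_mul hx'.le, mul_inv_cancel₀ ha.ne', rpow_one]
  have h2 : (x ^ a) ^ α = x ^ (a * α) := (rpow_mul hx'.le _ _).symm
  have h3 : x ^ (a * α + a - 1) = x ^ (a * α) * x ^ (a - 1) := by
    rw [← rpow_add hx']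
    congr 1
    ring
  simp only [h1, h2, h3, Complex.real_smul]
  push_cast
  ring

theorem integral_eq_integral_Ioi_add_neg {F : ℝ → ℂ} (h₁ : IntegrableOn F (Ioi 0))
    (h₂ : IntegrableOn (fun x => F (-x)) (Ioi 0)) :
    ∫ x, F x = ∫ x in Ioi (0 : ℝ), (F x + F (-x)) := by
  have h3 : IntegrableOn F (Iic 0) := by
    have A : MeasurableEmbedding fun x : ℝ => -x :=
      (Homeomorph.neg ℝ).isClosedEmbedding.measurableEmbedding
    rw [← Measure.map_neg_eq_self (volume : Measure ℝ), A.integrableOn_map_iff]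
    simpa [Function.comp_def] using (integrableOn_Ici_iff_integrableOn_Ioi (μ := volume)).2 h₂
  rw [← intervalIntegral.integral_Iic_add_Ioi h3 h₁, integral_add h₁ h₂]
  have := integral_comp_neg_Ioi 0 F
  rw [neg_zero] at this
  rw [this, add_comm]

/-- The reflection `x ↦ f (-x)` of a Schwartz function. -/
noncomputable def schwartzReflect (f : 𝓢(ℝ, ℂ)) : 𝓢(ℝ, ℂ) :=
  SchwartzMap.compCLMOfContinuousLinearEquiv ℂ (ContinuousLinearEquiv.neg ℝ) f

theorem schwartzReflect_apply (f : 𝓢(ℝ, ℂ)) (x : ℝ) : schwartzReflect f x = f (-x) := rfl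

/-- The generalized Fourier transform in terms of the Hankel transforms of the even and odd
parts. -/
theorem exists_transform_eq_hankel {κ a : ℝ} (ha : 0 < a) (hκa : 0 < 2 * (κ - 1 / 2) + a) :
    ∃ A B : ℂ, A ≠ 0 ∧ ∀ f e g : 𝓢(ℝ, ℂ), (∀ x, e x = f x + f (-x)) →
      (∀ x : ℝ, f x - f (-x) = x * g x) → ∀ y : ℝ, transform κ a f y =
        A * hankel (index κ a) (fun w => e (w ^ a⁻¹)) (|y| ^ a / a ^ 2) +
        B * y * hankel (index κ a + 2 / a) (fun w => g (w ^ a⁻¹)) (|y| ^ a / a ^ 2) := by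
  obtain ⟨c, hc⟩ := exists_kernel_eq κ ha
  have hν := neg_one_lt_index ha hκa
  have hμ : -1 < index κ a + 2 / a := by
    have : 0 < 2 / a := by positivity
    linarith
  have hα : -1 < index κ a + 1 / a := by
    have : 0 < 1 / a := by positivity
    linarith
  have hmul := mul_index (κ := κ) ha
  -- The three exponents count factors of `x`: none in the even term, one from `xy` in the kernel,
  -- and a second from writing the odd part as `x g`. Only the last matches the Bessel order `λ +
  -- 2/a`; the middle one serves for integrability before the splitting.
  have hexp0 : 2 * κ + a - 2 = a * index κ a + a - 1 := by linarith
  have hexp1 : 2 * κ + a - 2 + 1 = a * (index κ a + 1 / a) + a - 1 := by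
    rw [mul_add, mul_one_div_cancel ha.ne']
    linarith
  have hexp2 : 2 * κ + a - 2 + 1 + 1 = a * (index κ a + 2 / a) + a - 1 := by
    rw [mul_add, mul_div_cancel₀ _ ha.ne']
    linarith
  have hG := Gamma_pos_of_pos (show 0 < index κ a + 1 by linarith)
  set D : ℝ := (2 * a ^ index κ a * Gamma (index κ a + 1))⁻¹
  have hD : 0 < D := by positivity
  have ha' : (a : ℂ) ≠ 0 := Complex.ofReal_ne_zero.2 ha.ne'
  refine ⟨((Gamma (index κ a + 1) * D : ℝ) : ℂ) * (a : ℂ)⁻¹, c * D * (a : ℂ)⁻¹,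
    mul_ne_zero (Complex.ofReal_ne_zero.2 (mul_pos hG hD).ne') (inv_ne_zero ha'),
    fun f e g he hg y => ?_⟩
  set s := |y| ^ a / a ^ 2
  have hs : 0 ≤ s := by positivity
  set P : ℝ → ℂ := fun x =>
    ((besselClifford (index κ a) (x ^ a * s) * x ^ (2 * κ + a - 2) : ℝ) : ℂ)
  set R : ℝ → ℂ := fun x =>
    ((besselClifford (index κ a + 2 / a) (x ^ a * s) * x ^ (2 * κ + a - 2 + 1) : ℝ) : ℂ)
  set F : ℝ → ℂ := fun x => kernel κ a x y * f x * (density κ a x : ℂ)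
  have hpos : ∀ x ∈ Ioi (0 : ℝ), F x =
      ((Gamma (index κ a + 1) * D : ℝ) : ℂ) * (P x * f x) + c * D * y * (R x * f x) :=
    fun x hx => by
      have hx' : 0 < x := hx
      simp only [F, P, R, hc, density, abs_of_pos hx', rpow_add_one hx'.ne', s, D]
      push_cast
      ring
  have hneg : ∀ x ∈ Ioi (0 : ℝ), F (-x) =
      ((Gamma (index κ a + 1) * D : ℝ) : ℂ) * (P x * schwartzReflect f x) +
        -(c * D * y) * (R x * schwartzReflect f x) :=
    fun x hx => by
      have hx' : 0 < x := hx
      simp only [F, P, R, hc, density, abs_neg, abs_of_pos hx', rpow_add_one hx'.ne',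
        schwartzReflect_apply, s, D]
      push_cast
      ring
  have hP : ∀ φ : 𝓢(ℝ, ℂ), IntegrableOn (fun x => P x * φ x) (Ioi 0) := fun φ => by
    simp only [P, hexp0]
    exact integrableOn_besselClifford_comp_rpow ha hν hν hs φ
  have hR : ∀ φ : 𝓢(ℝ, ℂ), IntegrableOn (fun x => R x * φ x) (Ioi 0) := fun φ => by
    simp only [R, hexp1]
    exact integrableOn_besselClifford_comp_rpow ha hμ hα hs φ
  have hR2 : ∀ x ∈ Ioi (0 : ℝ), R x * (f - schwartzReflect f) x =
      ((besselClifford (index κ a + 2 / a) (x ^ a * s) *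
        x ^ (a * (index κ a + 2 / a) + a - 1) : ℝ) : ℂ) * g x := fun x hx => by
    have hx' : 0 < x := hx
    rw [← hexp2, rpow_add_one hx'.ne', sub_apply, schwartzReflect_apply, hg]
    simp only [R]
    push_cast
    ring
  have hsumP : ∀ x, P x * e x =
      ((besselClifford (index κ a) (x ^ a * s) * x ^ (a * index κ a + a - 1) : ℝ) : ℂ) * e x :=
    fun x => by simp only [P, hexp0]
  have h1 : transform κ a f y = ∫ x in Ioi (0 : ℝ), (F x + F (-x)) := by
    refine integral_eq_integral_Ioi_add_neg ?_ ?_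
    · exact IntegrableOn.congr_fun (((hP f).const_mul _).add ((hR f).const_mul _))
        (fun x hx => (hpos x hx).symm) measurableSet_Ioi
    · exact IntegrableOn.congr_fun (((hP (schwartzReflect f)).const_mul _).add
        ((hR (schwartzReflect f)).const_mul _))
        (fun x hx => (hneg x hx).symm) measurableSet_Ioi
  have h2 : ∀ x ∈ Ioi (0 : ℝ), F x + F (-x) =
      ((Gamma (index κ a + 1) * D : ℝ) : ℂ) * (P x * e x) +
        c * D * y * (R x * (f - schwartzReflect f) x) := fun x hx => by
    rw [hpos x hx, hneg x hx, he, sub_apply, schwartzReflect_apply]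
    ring
  rw [h1, setIntegral_congr_fun measurableSet_Ioi h2,
    integral_add ((hP e).const_mul _) ((hR (f - schwartzReflect f)).const_mul _),
    integral_const_mul, integral_const_mul]
  have h3 : ∫ x in Ioi (0 : ℝ), P x * e x =
      (a : ℂ)⁻¹ * hankel (index κ a) (fun w => e (w ^ a⁻¹)) s := by
    simp_rw [hsumP]
    exact integral_besselClifford_comp_rpow ha _ _ _ _
  have h4 : ∫ x in Ioi (0 : ℝ), R x * (f - schwartzReflect f) x =
      (a : ℂ)⁻¹ * hankel (index κ a + 2 / a) (fun w => g (w ^ a⁻¹)) s := by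
    rw [setIntegral_congr_fun measurableSet_Ioi hR2]
    exact integral_besselClifford_comp_rpow ha _ _ _ _
  rw [h3, h4]
  ring

theorem exists_even_odd_parts (f : 𝓢(ℝ, ℂ)) : ∃ e g : 𝓢(ℝ, ℂ), Function.Even e ∧
    Function.Even g ∧ (∀ x, e x = f x + f (-x)) ∧ ∀ x : ℝ, f x - f (-x) = x * g x := by
  obtain ⟨g, hg⟩ := exists_schwartzMap_eq_ofReal_mul (f - schwartzReflect f) (by
    rw [sub_apply, schwartzReflect_apply, neg_zero, sub_self])
  simp only [sub_apply, schwartzReflect_apply] at hg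
  refine ⟨f + schwartzReflect f, g, fun x => ?_, even_of_odd_eq_ofReal_mul (fun x => ?_) hg,
    fun x => rfl, hg⟩
  · simp only [add_apply, schwartzReflect_apply, neg_neg, add_comm]
  · simp only [neg_neg, neg_sub]

/-! ### Sufficiency of the two arithmetic conditions. -/

theorem contDiff_transform {κ a : ℝ} (ha : 0 < a) (hκa : 0 < 2 * (κ - 1 / 2) + a) {n : ℕ}
    (hn : a / 2 = n) (f : 𝓢(ℝ, ℂ)) : ContDiff ℝ ∞ (transform κ a f) := by
  obtain ⟨A, B, -, hAB⟩ := exists_transform_eq_hankel ha hκa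
  obtain ⟨e, g, -, -, he, hg⟩ := exists_even_odd_parts f
  have ht : ∀ y : ℝ, |y| ^ a / a ^ 2 = (y ^ 2) ^ n / a ^ 2 := fun y => by
    have h1 : a = ((2 * n : ℕ) : ℝ) := by
      push_cast
      linarith
    have h2 : |y| ^ a = |y| ^ (2 * n) := by rw [← rpow_natCast, ← h1]
    rw [h2, pow_mul, sq_abs]
  have hν := neg_one_lt_index ha hκa
  have hμ : -1 < index κ a + 2 / a := by
    have : 0 < 2 / a := by positivity
    linarith
  have hts : ContDiff ℝ ∞ fun y : ℝ => (y ^ 2) ^ n / a ^ 2 := by fun_prop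
  have ht0 : ∀ y : ℝ, 0 ≤ (y ^ 2) ^ n / a ^ 2 := fun y => by positivity
  have hr : ∀ φ : 𝓢(ℝ, ℂ), HalfLineRapid fun w => φ (w ^ a⁻¹) := fun φ =>
    halfLineRapid_comp_rpow φ (inv_pos.2 ha)
  rw [show transform κ a f = _ from funext (hAB f e g he hg)]
  simp_rw [ht]
  exact (contDiff_const.mul ((hr e).contDiff_hankel_comp hν hts ht0)).add
    ((contDiff_const.mul Complex.ofRealCLM.contDiff).mul
      ((hr g).contDiff_hankel_comp hμ hts ht0))

theorem exists_pow_mul_norm_comp_abs_rpow_le {a : ℝ} (ha : 0 < a) {H : ℝ → ℂ}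
    (hH : ∀ k : ℕ, ∃ C, ∀ s, 0 < s → s ^ k * ‖H s‖ ≤ C) (N : ℕ) :
    ∃ C, ∀ y : ℝ, 1 ≤ |y| → |y| ^ N * ‖H (|y| ^ a / a ^ 2)‖ ≤ C := by
  obtain ⟨k, hk⟩ := exists_nat_ge (N / a)
  obtain ⟨C, hC⟩ := hH k
  refine ⟨(a ^ 2) ^ k * C, fun y hy => ?_⟩
  have hy0 : 0 < |y| := by linarith
  have h1 : |y| ^ N ≤ (a ^ 2) ^ k * (|y| ^ a / a ^ 2) ^ k := by
    rw [← mul_pow, mul_div_cancel₀ _ (by positivity), ← rpow_natCast, ← rpow_natCast,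
      ← rpow_mul hy0.le]
    refine rpow_le_rpow_of_exponent_le hy ?_
    rw [div_le_iff₀ ha] at hk
    linarith
  calc _ ≤ (a ^ 2) ^ k * (|y| ^ a / a ^ 2) ^ k * ‖H (|y| ^ a / a ^ 2)‖ := by gcongr
    _ = (a ^ 2) ^ k * ((|y| ^ a / a ^ 2) ^ k * ‖H (|y| ^ a / a ^ 2)‖) := by ring
    _ ≤ _ := by
      gcongr
      exact hC _ (by positivity)

theorem rapidlyDecreasing_transform {κ a : ℝ} (ha : 0 < a) (hκa : 0 < 2 * (κ - 1 / 2) + a) {n : ℕ}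
    (hn : 2 / a = n) (f : 𝓢(ℝ, ℂ)) : RapidlyDecreasing (transform κ a f) := by
  obtain ⟨A, B, -, hAB⟩ := exists_transform_eq_hankel ha hκa
  obtain ⟨e, g, hee, hge, he, hg⟩ := exists_even_odd_parts f
  have hν := neg_one_lt_index ha hκa
  have h2a : 0 < 2 / a := by positivity
  have hμ : -1 < index κ a + 2 / a := by linarith
  have hn0 : 0 < n := by
    rw [hn] at h2a
    exact_mod_cast h2a
  have hinv : a⁻¹ = (n : ℝ) / 2 := by rw [← hn]; field_simp
  have hdec : ∀ {ν : ℝ}, -1 < ν → ∀ φ : 𝓢(ℝ, ℂ), Function.Even φ → ∀ k : ℕ, ∃ C, ∀ s, 0 < s →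
      s ^ k * ‖hankel ν (fun w => φ (w ^ a⁻¹)) s‖ ≤ C := fun hν φ hφ k => by
    simpa only [hinv, pow_zero, one_mul] using
      exists_pow_mul_norm_hankel_comp_rpow_le hn0 k hν φ hφ 0
  intro N
  -- One spare power of `|y|` turns boundedness into convergence to 0; the odd term needs a second
  -- to absorb its factor `y`.
  obtain ⟨C₁, h1⟩ := exists_pow_mul_norm_comp_abs_rpow_le ha (hdec hν e hee) (N + 1)
  obtain ⟨C₂, h2⟩ := exists_pow_mul_norm_comp_abs_rpow_le ha (hdec hμ g hge) (N + 2)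
  have habs : Tendsto (fun y : ℝ => |y|) (cocompact ℝ) atTop := tendsto_norm_cocompact_atTop
  have hlim : Tendsto (fun y : ℝ => (‖A‖ * C₁ + ‖B‖ * C₂) * |y|⁻¹) (cocompact ℝ) (𝓝 0) := by
    simpa using habs.inv_tendsto_atTop.const_mul (‖A‖ * C₁ + ‖B‖ * C₂)
  refine squeeze_zero' (Eventually.of_forall fun y => by positivity) ?_ hlim
  filter_upwards [habs.eventually_ge_atTop 1] with y hy
  have hy0 : 0 < |y| := by linarith
  have h1 := h1 y hy
  have h2 := h2 y hy
  rw [hAB f e g he hg y, ← div_eq_mul_inv, le_div_iff₀ hy0]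
  set H₁ := hankel (index κ a) (fun w => e (w ^ a⁻¹)) (|y| ^ a / a ^ 2)
  set H₂ := hankel (index κ a + 2 / a) (fun w => g (w ^ a⁻¹)) (|y| ^ a / a ^ 2)
  calc |y| ^ N * ‖A * H₁ + B * y * H₂‖ * |y|
      ≤ |y| ^ N * (‖A * H₁‖ + ‖B * y * H₂‖) * |y| := by
        gcongr
        exact norm_add_le _ _
    _ = ‖A‖ * (|y| ^ (N + 1) * ‖H₁‖) + ‖B‖ * (|y| ^ (N + 2) * ‖H₂‖) := by
        rw [norm_mul, norm_mul, norm_mul, Complex.norm_real, norm_eq_abs]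
        ring
    _ ≤ _ := by gcongr

/-! ### Necessity of the two arithmetic conditions. -/

/-- An even test function vanishing exactly to second order at the origin. -/
theorem exists_even_schwartzMap_sq_mul : ∃ (χ : ℝ → ℝ) (f : 𝓢(ℝ, ℂ)), Continuous χ ∧ χ 0 = 1 ∧
    (∀ x, 0 ≤ χ x) ∧ (∀ x, χ x ≤ 1) ∧ (∀ x, f (-x) = f x) ∧
    ∀ x, f x = ((x ^ 2 * χ x : ℝ) : ℂ) := by
  let b : ContDiffBump (0 : ℝ) := ⟨1, 2, one_pos, one_lt_two⟩
  have hsupp : HasCompactSupport fun x : ℝ => ((x ^ 2 * b x : ℝ) : ℂ) :=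
    (b.hasCompactSupport.mul_left (f := fun x : ℝ => x ^ 2)).comp_left Complex.ofReal_zero
  have hsmooth : ContDiff ℝ ∞ fun x : ℝ => ((x ^ 2 * b x : ℝ) : ℂ) :=
    Complex.ofRealCLM.contDiff.comp ((contDiff_id.pow 2).mul b.contDiff)
  refine ⟨b, hsupp.toSchwartzMap hsmooth, b.continuous, ?_, fun x => b.nonneg,
    fun x => b.le_one, fun x => ?_, fun x => rfl⟩
  · exact b.one_of_mem_closedBall (Metric.mem_closedBall_self zero_le_one)
  · change (((-x) ^ 2 * b (-x) : ℝ) : ℂ) = ((x ^ 2 * b x : ℝ) : ℂ)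
    rw [b.neg, neg_sq]

/-- The transform of an even function is a Hankel transform. -/
theorem exists_transform_even_eq_hankel {κ a : ℝ} (ha : 0 < a)
    (hκa : 0 < 2 * (κ - 1 / 2) + a) : ∃ A : ℂ, A ≠ 0 ∧ ∀ f : 𝓢(ℝ, ℂ), (∀ x, f (-x) = f x) →
      ∀ y : ℝ, transform κ a f y =
        A * hankel (index κ a) (fun w => f (w ^ a⁻¹)) (|y| ^ a / a ^ 2) := by
  obtain ⟨A, B, hA, hAB⟩ := exists_transform_eq_hankel ha hκa
  refine ⟨A * 2, mul_ne_zero hA two_ne_zero, fun f hf y => ?_⟩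
  -- For even `f` the sum `f(x) + f(-x)` is `2f` and the odd part is 0, whence the constant `A * 2`.
  rw [hAB f (f + f) 0 (fun x => by rw [hf]; rfl) (fun x => by rw [hf]; simp) y]
  simp only [hankel, add_apply, zero_apply, mul_zero, integral_zero, add_zero]
  rw [mul_assoc]
  congr 1
  rw [← integral_const_mul]
  congr 1
  funext w
  ring

theorem comp_rpow_inv_sq_mul {a : ℝ} {χ : ℝ → ℝ} {f : 𝓢(ℝ, ℂ)}
    (hf : ∀ x, f x = ((x ^ 2 * χ x : ℝ) : ℂ)) {w : ℝ} (hw : 0 < w) :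
    f (w ^ a⁻¹) = ((w ^ (2 / a) * χ (w ^ a⁻¹) : ℝ) : ℂ) := by
  have h : (w ^ a⁻¹) ^ 2 = w ^ (2 / a) := by
    rw [← rpow_natCast, ← rpow_mul hw.le]
    congr 1
    push_cast
    ring
  rw [hf, h]

/-- The test function becomes `w^(2/a) χ(w^(1/a))`, so the Laplace obstruction applies with `β =
2/a`, once decay in `y` is converted into decay in `s`. -/
theorem exists_two_div_eq_natCast {κ a : ℝ} (ha : 0 < a) (hκa : 0 < 2 * (κ - 1 / 2) + a)
    (hF : ∀ f : 𝓢(ℝ, ℂ), RapidlyDecreasing (transform κ a f)) : ∃ n : ℕ, 2 / a = n := by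
  obtain ⟨χ, f, hχc, hχ0, hχn, hχ1, hfe, hf⟩ := exists_even_schwartzMap_sq_mul
  obtain ⟨A, hA, hAf⟩ := exists_transform_even_eq_hankel ha hκa
  have hν := neg_one_lt_index ha hκa
  have hinv : 0 < a⁻¹ := inv_pos.2 ha
  have hh : HalfLineRapid fun w => f (w ^ a⁻¹) := halfLineRapid_comp_rpow f hinv
  refine hh.exists_eq_natCast_of_hankel_decay hν (β := 2 / a) (by positivity) (c := 1)
    one_ne_zero ?_ (B := 1) (fun w hw => ?_) fun k => ?_
  · have h1 : Tendsto (fun w : ℝ => ((χ (w ^ a⁻¹) : ℝ) : ℂ)) (𝓝[>] 0) (𝓝 1) := by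
      have hc : ContinuousAt (fun w : ℝ => ((χ (w ^ a⁻¹) : ℝ) : ℂ)) 0 :=
        Complex.continuous_ofReal.continuousAt.comp
          (hχc.continuousAt.comp (continuousAt_rpow_const 0 a⁻¹ (Or.inr hinv.le)))
      have := hc.tendsto
      rw [zero_rpow hinv.ne', hχ0, Complex.ofReal_one] at this
      exact tendsto_nhdsWithin_of_tendsto_nhds this
    refine h1.congr' ?_
    filter_upwards [self_mem_nhdsWithin] with w hw
    have h2 : ((w ^ (2 / a) : ℝ) : ℂ) ≠ 0 :=
      Complex.ofReal_ne_zero.2 (rpow_pos_of_pos hw _).ne'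
    rw [comp_rpow_inv_sq_mul hf hw, Complex.ofReal_mul, mul_div_cancel_left₀ _ h2]
  · have h2 := rpow_pos_of_pos hw (2 / a)
    rw [comp_rpow_inv_sq_mul hf hw, Complex.norm_real, norm_eq_abs, abs_mul, abs_of_pos h2,
      abs_of_nonneg (hχn _), one_mul]
    exact mul_le_of_le_one_right h2.le (hχ1 _)
  · set H := hankel (index κ a) fun w => f (w ^ a⁻¹)
    obtain ⟨C, hC⟩ := hh.exists_norm_hankel_le hν
    obtain ⟨N, hN⟩ := exists_nat_ge (a * k)
    have hA' : 0 < ‖A‖ := norm_pos_iff.2 hA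
    have h0 : Tendsto (fun y : ℝ => |y| ^ N * ‖transform κ a f y‖) (cocompact ℝ) (𝓝 0) := hF f N
    have h1 : ∀ᶠ y : ℝ in atTop, |y| ^ N * ‖transform κ a f y‖ < 1 :=
      atTop_le_cocompact (h0.eventually (gt_mem_nhds one_pos))
    obtain ⟨R₀, hR₀⟩ := eventually_atTop.1 h1
    set R := max R₀ 1
    have hR1 : 1 ≤ R := le_max_right _ _
    set s₀ := R ^ a / a ^ 2
    have hs₀ : 0 < s₀ := by positivity
    have hC0 : 0 ≤ C := by
      have := (norm_nonneg _).trans (hC 0 le_rfl)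
      simpa using this
    -- Up to `s₀` the linear growth bound suffices; beyond it, `y = (a^2 s)^(1/a)` lies where
    -- `|y|^N` times the transform is below 1, and `N ≥ ak`.
    refine ⟨max (s₀ ^ k * (C * (1 + s₀))) (((a ^ 2) ^ k)⁻¹ * ‖A‖⁻¹), fun s hs => ?_⟩
    rcases le_total s s₀ with hle | hle
    · refine le_trans ?_ (le_max_left _ _)
      gcongr
      refine (hC s hs.le).trans ?_
      gcongr
    · refine le_trans ?_ (le_max_right _ _)
      set y := (a ^ 2 * s) ^ a⁻¹
      have hy0 : 0 < y := by positivity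
      have hya : y ^ a = a ^ 2 * s := by
        rw [← rpow_mul (by positivity), inv_mul_cancel₀ ha.ne', rpow_one]
      have hys : |y| ^ a / a ^ 2 = s := by
        rw [abs_of_pos hy0, hya]
        field_simp
      have hRy : R ≤ y := by
        have : R ^ a ≤ y ^ a := by
          rw [hya]
          rw [div_le_iff₀ (by positivity)] at hle
          linarith
        exact (rpow_le_rpow_iff (by positivity) hy0.le ha).1 this
      have h2 := hR₀ y ((le_max_left _ _).trans hRy)
      rw [hAf f hfe y, hys, norm_mul, abs_of_pos hy0] at h2
      have h3 : (a ^ 2) ^ k * s ^ k ≤ y ^ N := by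
        rw [← mul_pow, ← hya, ← rpow_natCast, ← rpow_mul hy0.le, ← rpow_natCast]
        exact rpow_le_rpow_of_exponent_le (hR1.trans hRy) hN
      rw [← mul_inv, ← one_div, le_div_iff₀ (by positivity)]
      calc s ^ k * ‖H s‖ * ((a ^ 2) ^ k * ‖A‖) = (a ^ 2) ^ k * s ^ k * (‖A‖ * ‖H s‖) := by ring
        _ ≤ y ^ N * (‖A‖ * ‖H s‖) := by gcongr
        _ ≤ 1 := h2.le

theorem exists_half_eq_natCast {κ a : ℝ} (ha : 0 < a) (hκa : 0 < 2 * (κ - 1 / 2) + a)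
    (hF : ∀ f : 𝓢(ℝ, ℂ), ContDiff ℝ ∞ (transform κ a f)) : ∃ n : ℕ, a / 2 = n := by
  obtain ⟨χ, f, hχc, hχ0, hχn, -, hfe, hf⟩ := exists_even_schwartzMap_sq_mul
  obtain ⟨A, hA, hAf⟩ := exists_transform_even_eq_hankel ha hκa
  have hν := neg_one_lt_index ha hκa
  have hinv : 0 < a⁻¹ := inv_pos.2 ha
  have hh : HalfLineRapid fun w => f (w ^ a⁻¹) := halfLineRapid_comp_rpow f hinv
  set I : ℂ := ∫ w in Ioi (0 : ℝ), ((w ^ (index κ a + 1) : ℝ) : ℂ) * f (w ^ a⁻¹)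
  -- The integrand is nonnegative, and positive near 0 because `χ(0) = 1`.
  have hI : I ≠ 0 := by
    have h1 : I = ((∫ w in Ioi (0 : ℝ),
        w ^ (index κ a + 1) * (w ^ (2 / a) * χ (w ^ a⁻¹)) : ℝ) : ℂ) := by
      rw [← integral_complex_ofReal]
      refine setIntegral_congr_fun measurableSet_Ioi fun w hw => ?_
      simp only [comp_rpow_inv_sq_mul hf hw]
      push_cast
      ring
    rw [h1]
    refine Complex.ofReal_ne_zero.2 (ne_of_gt ?_)
    have h0 : ∀ w ∈ Ioi (0 : ℝ), 0 ≤ w ^ (index κ a + 1) * (w ^ (2 / a) * χ (w ^ a⁻¹)) :=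
      fun w hw => mul_nonneg (rpow_nonneg (le_of_lt hw) _)
        (mul_nonneg (rpow_nonneg (le_of_lt hw) _) (hχn _))
    rw [setIntegral_pos_iff_support_of_nonneg_ae
      ((ae_restrict_mem measurableSet_Ioi).mono h0) ?_]
    · have hc : ContinuousAt (fun w : ℝ => χ (w ^ a⁻¹)) 0 :=
        hχc.continuousAt.comp (continuousAt_rpow_const 0 a⁻¹ (Or.inr hinv.le))
      have h2 : ∀ᶠ w in 𝓝 (0 : ℝ), 0 < χ (w ^ a⁻¹) := by
        refine hc.eventually (lt_mem_nhds ?_)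
        simp only [zero_rpow hinv.ne', hχ0]
        exact one_pos
      obtain ⟨ε, hε, hball⟩ := Metric.eventually_nhds_iff.1 h2
      refine lt_of_lt_of_le ?_ (measure_mono (s := Ioo 0 ε) fun w hw => ?_)
      · simpa using hε
      · have h3 : 0 < χ (w ^ a⁻¹) := hball (by
          rw [dist_zero_right, norm_eq_abs, abs_of_pos hw.1]
          exact hw.2)
        refine ⟨?_, hw.1⟩
        have h4 := rpow_pos_of_pos hw.1 (index κ a + 1)
        have h5 := rpow_pos_of_pos hw.1 (2 / a)
        exact (mul_pos h4 (mul_pos h5 h3)).ne'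
    · refine IntegrableOn.congr_fun (hh.integrableOn_rpow_mul_norm
        (show -1 < index κ a + 1 by linarith)) (fun w hw => ?_) measurableSet_Ioi
      have h5 := rpow_pos_of_pos hw (2 / a)
      simp only [comp_rpow_inv_sq_mul hf hw, Complex.norm_real, norm_eq_abs, abs_mul,
        abs_of_pos h5, abs_of_nonneg (hχn _)]
  set F := transform κ a f
  set c₁ : ℂ := A * (-((besselClifford (index κ a + 1) 0 : ℝ) : ℂ) * I) * ((a : ℂ) ^ 2)⁻¹
  have ha' : (a : ℂ) ≠ 0 := Complex.ofReal_ne_zero.2 ha.ne'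
  have hc₁ : c₁ ≠ 0 := by
    refine mul_ne_zero (mul_ne_zero hA (mul_ne_zero (neg_ne_zero.2 ?_) hI))
      (inv_ne_zero (pow_ne_zero _ ha'))
    exact Complex.ofReal_ne_zero.2 (besselClifford_zero_pos (by linarith)).ne'
  have hslope : Tendsto (fun y : ℝ => (F y - F 0) / ((y ^ a : ℝ) : ℂ)) (𝓝[>] 0) (𝓝 c₁) := by
    have hs : Tendsto (fun y : ℝ => y ^ a / a ^ 2) (𝓝[>] 0) (𝓝[>] 0) := by
      refine tendsto_nhdsWithin_iff.2 ⟨?_, ?_⟩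
      · have hc : ContinuousAt (fun y : ℝ => y ^ a / a ^ 2) 0 :=
          (continuousAt_rpow_const 0 a (Or.inr ha.le)).div_const _
        have := hc.tendsto
        rw [zero_rpow ha.ne', zero_div] at this
        exact tendsto_nhdsWithin_of_tendsto_nhds this
      · filter_upwards [self_mem_nhdsWithin] with y hy
        have := rpow_pos_of_pos hy a
        exact mem_Ioi.2 (by positivity)
    have h1 := (((hh.tendsto_hankel_slope hν).comp hs).const_mul A).mul_const ((a : ℂ) ^ 2)⁻¹
    refine h1.congr' ?_
    filter_upwards [self_mem_nhdsWithin] with y hy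
    have h2 : ((y ^ a : ℝ) : ℂ) ≠ 0 := Complex.ofReal_ne_zero.2 (rpow_pos_of_pos hy a).ne'
    have h3 : F 0 = A * hankel (index κ a) (fun w => f (w ^ a⁻¹)) 0 := by
      simp only [F]
      rw [hAf f hfe 0, abs_zero, zero_rpow ha.ne', zero_div]
    have h4 : F y = A * hankel (index κ a) (fun w => f (w ^ a⁻¹)) (y ^ a / a ^ 2) := by
      simp only [F]
      rw [hAf f hfe y, abs_of_pos hy]
    rw [h3, h4]
    simp only [Function.comp]
    push_cast
    field_simp
  have hFe : ∀ y, F (-y) = F y := fun y => by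
    simp only [F]
    rw [hAf f hfe, hAf f hfe, abs_neg]
  obtain ⟨N, hN⟩ := exists_nat_gt a
  obtain ⟨Q, hQ⟩ := exists_polynomial_isLittleO (hF f) N
  -- Stated for arbitrary `P` because it is used for both `Q(y)` and `Q(-y)`, which approximate the
  -- even function `F` equally well. Comparing coefficients gives `(-1)^n c₁ = c₁`, so `n` is even.
  have hpoly : ∀ P : Polynomial ℂ, (fun y : ℝ => F y - P.eval (y : ℂ)) =O[𝓝 0] (fun y => y ^ N) →
      ∃ n : ℕ, a = n ∧ P.coeff n = c₁ := fun P hP => by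
    refine exists_eq_natCast_of_tendsto_polynomial P (c₀ := F 0) hc₁ ha ?_
    obtain ⟨K, hK⟩ := hP.bound
    have hdiff : Tendsto (fun y : ℝ => (F y - P.eval (y : ℂ)) / ((y ^ a : ℝ) : ℂ)) (𝓝[>] 0)
        (𝓝 0) := by
      refine squeeze_zero_norm' (a := fun y : ℝ => K * y ^ ((N : ℝ) - a)) ?_ ?_
      · filter_upwards [self_mem_nhdsWithin, nhdsWithin_le_nhds hK] with y hy hKy
        have hy' : 0 < y := hy
        have h3 := rpow_pos_of_pos hy' a
        rw [norm_div, Complex.norm_real, norm_eq_abs, abs_of_pos h3, div_le_iff₀ h3, mul_assoc,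
          ← rpow_add hy', sub_add_cancel, rpow_natCast]
        refine hKy.trans_eq ?_
        rw [norm_eq_abs, abs_of_pos (by positivity)]
      · have h2 : (0 : ℝ) < N - a := by linarith
        have := ((continuous_rpow_const h2.le).tendsto 0).const_mul K
        rw [zero_rpow h2.ne', mul_zero] at this
        exact tendsto_nhdsWithin_of_tendsto_nhds this
    refine ((hslope.sub hdiff).congr fun y => ?_).trans_eq ?_
    · ring
    · rw [sub_zero]
  obtain ⟨n, hn, hQn⟩ := hpoly Q hQ.isBigO
  obtain ⟨m, hm, hQm⟩ := hpoly (Q.comp (Polynomial.C (-1) * Polynomial.X)) (by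
    have h1 : Tendsto (fun y : ℝ => -y) (𝓝 0) (𝓝 0) := by
      simpa using (continuous_neg (G := ℝ)).tendsto 0
    have h2 := (hQ.isBigO.comp_tendsto h1)
    refine (h2.congr_left fun y => ?_).trans (Asymptotics.IsBigO.of_bound 1
      (Eventually.of_forall fun y => ?_))
    · simp only [Function.comp_apply, Polynomial.eval_comp, Polynomial.eval_mul, Polynomial.eval_C,
        Polynomial.eval_X, neg_one_mul, Complex.ofReal_neg]
      exact congrArg (· - _) (hFe y)
    · simp)
  have hmn : m = n := by exact_mod_cast hm.symm.trans hn
  rw [hmn, Polynomial.comp_C_mul_X_coeff, hQn] at hQm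
  have heven : Even n := by
    by_contra hodd
    rw [Nat.not_even_iff_odd] at hodd
    rw [hodd.neg_one_pow] at hQm
    refine hc₁ ?_
    linear_combination -hQm / 2
  obtain ⟨j, hj⟩ := heven
  refine ⟨j, ?_⟩
  rw [hn, hj]
  push_cast
  ring

end GenFourier

theorem mainTheorem9 (κ a : ℝ) (ha : 0 < a) (hκ : 0 ≤ κ) (hκa : 0 < 2 * (κ - 1 / 2) + a) :
    ((∀ f : 𝓢(ℝ, ℂ), ContDiff ℝ ∞ (GenFourier.transform κ a f)) ↔ ∃ n : ℕ, a / 2 = n) ∧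
    ((∀ f : 𝓢(ℝ, ℂ), GenFourier.RapidlyDecreasing (GenFourier.transform κ a f)) ↔
      ∃ n : ℕ, 2 / a = n) :=
  ⟨⟨GenFourier.exists_half_eq_natCast ha hκa,
      fun ⟨_, hn⟩ => GenFourier.contDiff_transform ha hκa hn⟩,
    ⟨GenFourier.exists_two_div_eq_natCast ha hκa,
      fun ⟨_, hn⟩ => GenFourier.rapidlyDecreasing_transform ha hκa hn⟩⟩
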